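/- **Theorem 2 (lower bound).** There is an absolute constant $c>0$ such that the following holds. Let $E$ be a separable real Hilbert space (of finite or countably infinite dimension), and let $\mathcal D_S,\mathcal D_T$ (source, target) be probability distributions of $(x,y)\in E\times\mathbb R$ with $\mathbb E\|x\|^4<\infty$. Put $G=\mathbb E_{\mathcal D_S}[xx^\top]$, $H=\mathbb E_{\mathcal D_T}[xx^\top]$, with orthonormal eigenbases and eigenvalues $(\mu_j)$ of $G$ and $(\lambda_k)$ of $H$. For an index set $\mathbb J$ let $G_{\mathbb J}=\sum_{j\in\mathbb J}\mu_j u_ju_j^\top$, $G_{\mathbb J}^{-1}=\sum_{j\in\mathbb J}\mu_j^{-1}u_ju_j^\top$, $I_{\mathbb J}=\sum_{j\in\mathbb J}u_ju_j^\top$, where $u_j$ are the eigenvectors of $G$; define $H_{\mathbb K}$, $I_{\mathbb K}$ likewise from $H$. Write $\|v\|_A^2=\langle v,Av\rangle$. Assume: * there is $\beta>0$ such that for every positive semidefinite bounded operator $A$, $\mathbb E_{\mathcal D_S}[xx^\top Axx^\top]-GAG\succeq\beta\,\mathrm{tr}(GA)\,G$ and $\mathbb E_{\mathcal D_T}[xx^\top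 Axx^\top]-HAH\succeq\beta\,\mathrm{tr}(HA)\,H$; * for some $w^*\in E$ and $\sigma>0$, under both distributions $y=\langle w^*,x\rangle+\epsilon$ with $\epsilon\sim\mathcal N(0,\sigma^2)$ independent of $x$; * $M_{\rm eff}:=M/\log M\ge10$, $N_{\rm eff}:=N/\log N\ge10$, $0<\gamma_0<1/\|G\|$ and $0<\gamma_M<1/\|H\|$. Let $(x_t,y_t)_{t=1}^{M+N}$ be independent, drawn from $\mathcal D_S$ for $t\le M$ and from $\mathcal D_T$ for $t>M$. Let $w_0\in E$ and $w_t=w_{t-1}-\gamma_{t-1}(x_tx_t^\top w_{t-1}-x_ty_t)$, where $\gamma_t=\gamma_0/2^{\lfloor t/M_{\rm eff}\rfloor}$ for $0\le t<M$ and $\gamma_t=\gamma_M/2^{\lfloor (t-M)/N_{\rm eff}\rfloor}$ for $M\le t<M+N$. Let $\mathcal R_T(w)=\tfrac12\mathbb E_{\mathcal D_T}(y-\langle w,x\rangle)^2$ and $\Delta(w)=\mathcal R_T(w)-\mathcal R_T(w^*)$. Define $B_0=(w_0-w^*)(w_0-w^*)^\top$, $C_0=0$ and, for $t=1,\dots,M+N$,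 with $\mathbb E_t$ the expectation under the distribution of the $t$-th sample and $\Sigma_t=\mathbb E_t[xx^\top]$, $$B_t=B_{t-1}-\gamma_{t-1}(\Sigma_tB_{t-1}+B_{t-1}\Sigma_t)+\gamma_{t-1}^2\mathbb E_t[xx^\top B_{t-1}xx^\top],$$ $$C_t=C_{t-1}-\gamma_{t-1}(\Sigma_tC_{t-1}+C_{t-1}\Sigma_t)+\gamma_{t-1}^2\mathbb E_t[xx^\top C_{t-1}xx^\top]+\gamma_{t-1}^2\mathbb E_t[(y-\langle w^*,x\rangle)^2xx^\top].$$ Set $\mathrm{Bias}=\tfrac12\mathrm{tr}(HB_{M+N})$ and $\mathrm{Var}=\tfrac12\mathrm{tr}(HC_{M+N})$. Then $\Delta(w_{M+N})$ is integrable and $$\mathbb E[\Delta(w_{M+N})]=\mathrm{Bias}+\mathrm{Var}.$$ Moreover, with $\mathbb J=\{j:\mu_j\ge1/(\gamma_0M_{\rm eff})\}$, $\mathbb K=\{k:\lambda_k\ge1/(\gamma_MN_{\rm eff})\}$, $$D^{\rm ft}=\mathrm{tr}\Big(\prod_{t=0}^{N-1}(I-\gamma_{M+t}H)^2H\,(G_{\mathbb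 J}^{-1}+M_{\rm eff}^2\gamma_0^2G_{\mathbb J^c})\Big),\qquad D=|\mathbb K|+N_{\rm eff}^2\gamma_M^2\sum_{i\notin\mathbb K}\lambda_i^2,$$ $v=\prod_{t=0}^{M-1}(I-\gamma_tG)(w_0-w^*)$ and $u=\prod_{t=M}^{M+N-1}(I-\gamma_tH)v$, one has $$\mathrm{Var}\ge c\,V,\qquad V:=\sigma^2\Big(\frac{D^{\rm ft}}{M_{\rm eff}}+\frac{D}{N_{\rm eff}}\Big),$$ $$\mathrm{Bias}\ge c\,L,\qquad L:=\|u\|_H^2+\beta\|w_0-w^*\|^2_{G_{\mathbb J^c}}\frac{D^{\rm ft}}{M_{\rm eff}}+\beta\|v\|^2_{H_{\mathbb K^c}}\frac{D}{N_{\rm eff}}.$$ Finally, for $\alpha\ge\beta$ let $Q=\|w_0-w^*\|^2_{\frac{I_{\mathbb J}}{M_{\rm eff}\gamma_0}+G_{\mathbb J^c}}$ and let $$U_\alpha:=\|u\|_H^2+\alpha Q\,\frac{D^{\rm ft}}{M_{\rm eff}}+\alpha\Big(\|v\|^2_{\frac{I_{\mathbb K}}{N_{\rm eff}\gamma_M}+H_{\mathbb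 K^c}}+Q\Big)\frac{D}{N_{\rm eff}}$$ be the bias expression of the corresponding upper bound. If $\|w_0-w^*\|_G^2\le R\sigma^2$ and $\|v\|_H^2\le R\sigma^2$, then $V+L\le V+U_\alpha$ and $c\,(V+U_\alpha)\le(1+\alpha R)(V+L)$, that is, the lower and upper expressions match up to constants. -/

import Mathlib

open MeasureTheory ProbabilityTheory
open scoped RealInnerProductSpace

namespace CovShift

noncomputable section

variable {E : Type*} [NormedAddCommGroup E] [InnerProductSpace ℝ E]

/-! ### Hilbert space notation -/

/-- The operator `x xᵀ : v ↦ ⟪x, v⟫ x`. -/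
def outer (x : E) : E →L[ℝ] E := InnerProductSpace.rankOne ℝ x x

/-- The trace `∑ i, ⟪b i, A (b i)⟫` of an operator, computed in the orthonormal basis `b`. It is only
applied to trace class operators, for which the series converges absolutely and the value does
not depend on `b`. -/
def trace {ι : Type*} (b : HilbertBasis ι ℝ E) (A : E →L[ℝ] E) : ℝ := ∑' i, ⟪b i, A (b i)⟫

/-- `‖v‖²_A = vᵀ A v`. -/
def sqNorm (A : E →L[ℝ] E) (v : E) : ℝ := ⟪v, A v⟫

/-- `∑_{i ∈ S} f i • b i (b i)ᵀ`. For an eigenbasis `b` of `A` with eigenvalues `f` this is `A_S`;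
with `f⁻¹` in place of `f` it is `A_S⁻¹`, and with a constant `a` it is `a I_S`. -/
def specPart {ι : Type*} (b : HilbertBasis ι ℝ E) (f : ι → ℝ) (S : Set ι) : E →L[ℝ] E :=
  ∑' i : S, f i • outer (b i)

/-- `b` is an orthonormal basis of eigenvectors of `A`, with eigenvalues `ev`. -/
def IsEigenbasis {ι : Type*} (A : E →L[ℝ] E) (b : HilbertBasis ι ℝ E) (ev : ι → ℝ) : Prop :=
  ∀ i, A (b i) = ev i • b i

/-! ### Data distributions on pairs `(x, y)` -/

variable [MeasurableSpace E]

/-- `𝔼[x xᵀ]`. -/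
def covOp (D : Measure (E × ℝ)) : E →L[ℝ] E := ∫ z, outer z.1 ∂D

/-- `𝔼[x xᵀ A x xᵀ]`. -/
def fourthOp (D : Measure (E × ℝ)) (A : E →L[ℝ] E) : E →L[ℝ] E :=
  ∫ z, outer z.1 * A * outer z.1 ∂D

/-- `𝔼[(y - ⟪w, x⟫)² x xᵀ]`. -/
def noiseOp (D : Measure (E × ℝ)) (w : E) : E →L[ℝ] E :=
  ∫ z, (z.2 - ⟪w, z.1⟫) ^ 2 • outer z.1 ∂D

/-- `½ 𝔼 (y - ⟪w, x⟫)²`. -/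
def risk (D : Measure (E × ℝ)) (w : E) : ℝ := (1 / 2) * ∫ z, (z.2 - ⟪w, z.1⟫) ^ 2 ∂D

/-- Excess risk of `w` relative to the risk minimizer `wstar`. -/
def excessRisk (D : Measure (E × ℝ)) (wstar w : E) : ℝ := risk D w - risk D wstar

/-- The covariates have a finite fourth moment, and for every positive semidefinite `A`,
`𝔼[x xᵀ A x xᵀ] - G A G ⪰ β tr(G A) G`, where `G = 𝔼[x xᵀ]` (the order is the Loewner order). The
trace is computed in the orthonormal basis `b`. -/
structure FourthMomentLower {ι : Type*} (D : Measure (E × ℝ)) (b : HilbertBasis ι ℝ E) (β : ℝ) :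
    Prop where
  finite_fourth : Integrable (fun z : E × ℝ => ‖z.1‖ ^ 4) D
  lower : ∀ A : E →L[ℝ] E, A.IsPositive →
    (β * trace b (covOp D * A)) • covOp D ≤ fourthOp D A - covOp D * A * covOp D

/-- Under `D` the response is `y = ⟪wstar, x⟫ + ε` with `ε ∼ 𝒩(0, σ²)` independent of `x`. -/
structure WellSpecified (D : Measure (E × ℝ)) (wstar : E) (σ : ℝ) : Prop where
  noise_law : HasLaw (fun z : E × ℝ => z.2 - ⟪wstar, z.1⟫)
    (gaussianReal 0 ⟨σ ^ 2, sq_nonneg σ⟩) D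
  noise_indep : IndepFun (fun z : E × ℝ => z.1) (fun z : E × ℝ => z.2 - ⟪wstar, z.1⟫) D

/-! ### Stepsizes and SGD -/

/-- Effective sample size `n / log n`. -/
def nEff (n : ℕ) : ℝ := n / Real.log n

/-- Geometrically decaying stepsizes: `γ₀ / 2^⌊t / M_eff⌋` for `t < M` (pretraining), and
`γ_M / 2^⌊(t - M) / N_eff⌋` for `t ≥ M` (finetuning). -/
def stepsize (M N : ℕ) (γ₀ γM : ℝ) (t : ℕ) : ℝ :=
  if t < M then γ₀ / 2 ^ ⌊(t : ℝ) / nEff M⌋₊ else γM / 2 ^ ⌊((t : ℝ) - M) / nEff N⌋₊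

/-- The distribution of the sample used in step `t + 1`: the first `M` samples come from the source,
the later ones from the target. -/
def phaseLaw (DS DT : Measure (E × ℝ)) (M t : ℕ) : Measure (E × ℝ) := if t < M then DS else DT

/-- The SGD iterates on the data stream `z 0, z 1, …`; step `t + 1` uses the sample `z t`. -/
def sgd (γ : ℕ → ℝ) (w₀ : E) (z : ℕ → E × ℝ) : ℕ → E
  | 0 => w₀
  | t + 1 => sgd γ w₀ z t -
      γ t • (outer (z t).1 (sgd γ w₀ z t) - (z t).2 • (z t).1)

/-! ### Bias and variance -/

/-- `(ℐ - γ 𝒯(γ)) ∘ A = A - γ (G A + A G - γ 𝔼[x xᵀ A x xᵀ])`, where `G = 𝔼[x xᵀ]`. -/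
def iterOp (D : Measure (E × ℝ)) (γ : ℝ) (A : E →L[ℝ] E) : E →L[ℝ] E :=
  A - γ • (covOp D * A + A * covOp D - γ • fourthOp D A)

/-- Bias iterates `B_t`. -/
def biasIter (DS DT : Measure (E × ℝ)) (M : ℕ) (γ : ℕ → ℝ) (w₀ wstar : E) : ℕ → (E →L[ℝ] E)
  | 0 => outer (w₀ - wstar)
  | t + 1 => iterOp (phaseLaw DS DT M t) (γ t) (biasIter DS DT M γ w₀ wstar t)

/-- Variance iterates `C_t`. -/
def varIter (DS DT : Measure (E × ℝ)) (M : ℕ) (γ : ℕ → ℝ) (wstar : E) : ℕ → (E →L[ℝ] E)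
  | 0 => 0
  | t + 1 => iterOp (phaseLaw DS DT M t) (γ t) (varIter DS DT M γ wstar t) +
      γ t ^ 2 • noiseOp (phaseLaw DS DT M t) wstar

/-- `½ ⟨H, B_{M+N}⟩`, where `⟨A, B⟩ = tr(A B)`. -/
def biasErr {κ : Type*} (bH : HilbertBasis κ ℝ E) (DS DT : Measure (E × ℝ)) (M N : ℕ) (γ : ℕ → ℝ)
    (w₀ wstar : E) : ℝ :=
  (1 / 2) * trace bH (covOp DT * biasIter DS DT M γ w₀ wstar (M + N))

/-- `½ ⟨H, C_{M+N}⟩`. -/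
def varErr {κ : Type*} (bH : HilbertBasis κ ℝ E) (DS DT : Measure (E × ℝ)) (M N : ℕ) (γ : ℕ → ℝ)
    (wstar : E) : ℝ :=
  (1 / 2) * trace bH (covOp DT * varIter DS DT M γ wstar (M + N))

/-! ### Effective dimensions -/

/-- `∏_{t=s}^{s+n-1} (I - γ_t A)`; the factors commute. -/
def contraction (γ : ℕ → ℝ) (A : E →L[ℝ] E) (s n : ℕ) : E →L[ℝ] E :=
  ((List.range n).map fun t => 1 - γ (s + t) • A).prod

/-- `D_eff = |K| + N_eff² γ_M² ∑_{i ∉ K} λ_i²`, with `a = N_eff γ_M`. -/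
def dEff {κ : Type*} (ev : κ → ℝ) (K : Set κ) (a : ℝ) : ℝ :=
  K.ncard + a ^ 2 * ∑' i : (Kᶜ : Set κ), ev i ^ 2

/-- `D_eff^finetune = tr(∏_{t<N} (I - γ_{M+t} H)² H (G_J⁻¹ + M_eff² γ₀² G_{Jᶜ}))`, with
`a = M_eff γ₀`. -/
def dEffFinetune {ι κ : Type*} (bG : HilbertBasis ι ℝ E) (μ : ι → ℝ) (J : Set ι)
    (bH : HilbertBasis κ ℝ E) (H : E →L[ℝ] E) (γ : ℕ → ℝ) (M N : ℕ) (a : ℝ) : ℝ :=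
  trace bH (contraction γ H M N ^ 2 * H * (specPart bG (fun i => (μ i)⁻¹) J + a ^ 2 • specPart bG μ Jᶜ))

end

end CovShift

open CovShift

set_option linter.unusedSectionVars false

/-! The error `w_t - w*` obeys a random linear recursion driven by fresh samples whose noise is
centred and independent of the covariates. Its second moment is therefore exactly `B_t + C_t`
(`hasSecondMoment_sgd`). The excess risk is half the quadratic form of `H` at the error
(`excessRisk_eq`), so integrating gives Bias + Var (`HasSecondMoment.integral_quadratic`).

For the lower bounds, both recursions have the form `A ↦ (I - γΣ) A (I - γΣ) + γ² (𝔼[xxᵀAxxᵀ] - ΣAΣ)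
+ γ² ν Σ`, with `ν = 0` for the bias and `ν = σ²` for the variance. The fourth moment assumption
bounds the middle term below by `γ² β tr(ΣA) Σ` (`iterOp_ge`). If `A` starts above `wwᵀ`, it stays
above the contracted copy of `wwᵀ`. Eigendirections below `1/(γ₀ m)` contract only by a constant
factor, so `tr(ΣA)` never drops below a constant times the tail norm of `w`
(`sqNorm_contraction_ge`). The random design thus acts as extra label noise of fixed size.

What remains is noise with covariance proportional to `Σ`, diagonal in its eigenbasis: the scalar
recursion `accum`. The first `m` steps have constant stepsize and build up the required level.
Afterwards, a step with `γ_t λ ≥ 1/m` replenishes the noise it removes, while steps with `γ_t λ <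
1/m` have bounded sum and cost a constant factor (`accum_decay_ge`). The level reached is of order
`1/(mλ)` in the head and `mγ²λ` in the tail, which gives `phase_ge`.

The two phases need no common eigenbasis: conjugation by the target contraction preserves the
Loewner order, and the trace against `H` is monotone. Source noise contributes `D^ft` and target
noise contributes `D` (`two_phase_ge`). The comparison with the upper expression is arithmetic:
under the signal-to-noise bounds the variance absorbs the `α` terms (`rate_comparison`). -/

namespace CovShift

/-! ### Geometrically decaying stepsizes -/

/-- The stepsizes `g / 2^⌊t / m⌋` of one phase. -/
noncomputable def decay (m g : ℝ) (t : ℕ) : ℝ := g / 2 ^ ⌊(t : ℝ) / m⌋₊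

lemma decay_nonneg {m g : ℝ} (hg : 0 ≤ g) (t : ℕ) : 0 ≤ decay m g t := by
  unfold decay; positivity

lemma decay_le {m g : ℝ} (hg : 0 ≤ g) (t : ℕ) : decay m g t ≤ g :=
  div_le_self hg (one_le_pow₀ (by norm_num))

lemma decay_mul (m g a : ℝ) (t : ℕ) : decay m g t * a = decay m (g * a) t := by
  unfold decay; ring

lemma decay_eq_of_lt {m g : ℝ} (hm : 0 < m) {t : ℕ} (ht : (t : ℝ) < m) : decay m g t = g := by
  have : ⌊(t : ℝ) / m⌋₊ = 0 := Nat.floor_eq_zero.2 ((div_lt_one hm).2 ht)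
  simp [decay, this]

/-- The floor is superadditive. Rounding the real period `m` up to an integer lets later steps be
grouped into blocks of equal length. -/
lemma decay_add_le {m g : ℝ} (hm : 0 < m) (hg : 0 ≤ g) (s i : ℕ) :
    decay m g (s + i) ≤ decay m g s * (1 / 2) ^ (i / ⌈m⌉₊) := by
  have h1 : i / ⌈m⌉₊ ≤ ⌊(i : ℝ) / m⌋₊ := by
    apply Nat.le_floor
    refine (Nat.cast_div_le (α := ℝ)).trans ?_
    exact div_le_div_of_nonneg_left (by positivity) hm (Nat.le_ceil m)
  have h2 : ⌊(s : ℝ) / m⌋₊ + i / ⌈m⌉₊ ≤ ⌊((s + i : ℕ) : ℝ) / m⌋₊ := by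
    refine (Nat.add_le_add_left h1 _).trans ?_
    apply Nat.le_floor
    push_cast
    rw [add_div]
    exact add_le_add (Nat.floor_le (by positivity)) (Nat.floor_le (by positivity))
  unfold decay
  rw [one_div, inv_pow, ← div_eq_mul_inv, div_div, ← pow_add]
  exact div_le_div_of_nonneg_left hg (by positivity) (pow_le_pow_right₀ (by norm_num) h2)

/-- Peel off the first block: it contributes `p`, and the rest is half of a shorter sum of the same
kind, hence at most `p`. -/
lemma sum_half_pow_div_le {p : ℕ} (hp : 0 < p) (n : ℕ) :
    ∑ i ∈ Finset.range n, (1 / 2 : ℝ) ^ (i / p) ≤ 2 * p := by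
  induction n using Nat.strong_induction_on with
  | _ n ih =>
    rcases lt_or_ge n p with h | h
    · calc ∑ i ∈ Finset.range n, (1 / 2 : ℝ) ^ (i / p) ≤ ∑ i ∈ Finset.range n, 1 :=
            Finset.sum_le_sum fun i _ => pow_le_one₀ (by norm_num) (by norm_num)
        _ = n := by simp
        _ ≤ 2 * p := by
          have : (n : ℝ) ≤ p := by exact_mod_cast h.le
          have : (0 : ℝ) ≤ p := by positivity
          linarith
    · obtain ⟨k, rfl⟩ := Nat.exists_eq_add_of_le h
      have ihk := ih k (by omega)
      rw [Finset.sum_range_add]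
      have h1 : ∑ i ∈ Finset.range p, (1 / 2 : ℝ) ^ (i / p) = p := by
        rw [Finset.sum_congr rfl (g := fun _ => (1 : ℝ))]
        · simp
        · intro i hi
          rw [Nat.div_eq_of_lt (Finset.mem_range.1 hi), pow_zero]
      have h2 : ∑ i ∈ Finset.range k, (1 / 2 : ℝ) ^ ((p + i) / p)
          = (1 / 2) * ∑ i ∈ Finset.range k, (1 / 2 : ℝ) ^ (i / p) := by
        rw [Finset.mul_sum]
        refine Finset.sum_congr rfl fun i _ => ?_
        rw [Nat.add_div_left _ hp, pow_succ, mul_comm]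
      rw [h1, h2]
      linarith

/-- The stepsizes below `1 / m` have a bounded sum. -/
lemma sum_decay_small_le {m x : ℝ} (hm : 10 ≤ m) (hx : 0 ≤ x) (n : ℕ) :
    ∑ s ∈ Finset.range n with decay m x s < 1 / m, decay m x s ≤ 9 / 4 := by
  have hm0 : 0 < m := by linarith
  by_cases hex : ∃ s, decay m x s < 1 / m
  swap
  · push Not at hex
    rw [Finset.filter_false_of_mem fun s _ => not_lt.2 (hex s)]
    norm_num
  classical
  -- All small stepsizes occur at or after the first one, so they are dominated by a geometric block
  -- sum starting at `s₀`.
  set s₀ := Nat.find hex with hs₀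
  have hs : decay m x s₀ < 1 / m := Nat.find_spec hex
  have hp : 0 < ⌈m⌉₊ := Nat.ceil_pos.2 hm0
  calc ∑ s ∈ Finset.range n with decay m x s < 1 / m, decay m x s
      ≤ ∑ s ∈ (Finset.range n).image (s₀ + ·), decay m x s := by
        refine Finset.sum_le_sum_of_subset_of_nonneg ?_ fun _ _ _ => decay_nonneg hx _
        intro s hs'
        simp only [Finset.mem_filter, Finset.mem_range, Finset.mem_image] at hs' ⊢
        have : s₀ ≤ s := Nat.find_min' hex hs'.2
        exact ⟨s - s₀, by omega, by omega⟩
    _ = ∑ i ∈ Finset.range n, decay m x (s₀ + i) := by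
        rw [Finset.sum_image fun a _ b _ h => by simpa using h]
    _ ≤ ∑ i ∈ Finset.range n, decay m x s₀ * (1 / 2) ^ (i / ⌈m⌉₊) :=
        Finset.sum_le_sum fun i _ => decay_add_le hm0 hx s₀ i
    _ = decay m x s₀ * ∑ i ∈ Finset.range n, (1 / 2 : ℝ) ^ (i / ⌈m⌉₊) := by rw [Finset.mul_sum]
    _ ≤ 1 / m * (2 * ⌈m⌉₊) :=
        mul_le_mul hs.le (sum_half_pow_div_le hp n) (Finset.sum_nonneg fun _ _ => by positivity)
          (by positivity)
    -- `2 (m + 1) / m ≤ 9/4` already holds for `m ≥ 8`.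
    _ ≤ 9 / 4 := by
        have := Nat.ceil_lt_add_one hm0.le
        rw [one_div, inv_mul_le_iff₀ hm0]
        linarith

/-- On this range `1 / (1 - x) ≤ 1 + 2x ≤ exp (2x)`. -/
lemma exp_neg_two_mul_le {x : ℝ} (hx : 0 ≤ x) (hx' : x ≤ 1 / 2) : Real.exp (-(2 * x)) ≤ 1 - x := by
  rw [Real.exp_neg, inv_le_comm₀ (Real.exp_pos _) (by linarith)]
  refine le_trans ?_ (Real.add_one_le_exp _)
  rw [inv_le_iff_one_le_mul₀ (by linarith)]
  nlinarith

/-- The contraction caused by the stepsizes below `1 / m` is bounded below. -/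
lemma exp_le_prod_decay_small {m x : ℝ} (hm : 10 ≤ m) (hx : 0 ≤ x) (n : ℕ) :
    Real.exp (-9) ≤ ∏ s ∈ Finset.range n with decay m x s < 1 / m, (1 - decay m x s) ^ 2 := by
  have h := sum_decay_small_le hm hx n
  -- Each factor is at least `exp (-4 γ_s)`, and `4 · 9/4 = 9`.
  calc Real.exp (-9)
      ≤ Real.exp (∑ s ∈ Finset.range n with decay m x s < 1 / m, -(4 * decay m x s)) := by
        rw [Real.exp_le_exp, Finset.sum_neg_distrib, ← Finset.mul_sum]
        linarith
    _ = ∏ s ∈ Finset.range n with decay m x s < 1 / m, Real.exp (-(4 * decay m x s)) :=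
        Real.exp_sum _ _
    _ ≤ _ := by
        refine Finset.prod_le_prod (fun _ _ => (Real.exp_pos _).le) fun s hs => ?_
        have h1 : decay m x s < 1 / m := (Finset.mem_filter.1 hs).2
        have h2 : 1 / m ≤ 1 / 10 := one_div_le_one_div_of_le (by norm_num) hm
        have h3 := exp_neg_two_mul_le (decay_nonneg (m := m) hx s) (by linarith)
        have : -(4 * decay m x s) = (2 : ℕ) * (-(2 * decay m x s)) := by push_cast; ring
        rw [this, Real.exp_nat_mul]
        exact pow_le_pow_left₀ (Real.exp_pos _).le h3 2

lemma exp_le_prod_decay {m x : ℝ} (hm : 10 ≤ m) (hx : 0 ≤ x) (hxm : x < 1 / m) (n : ℕ) :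
    Real.exp (-9) ≤ (∏ s ∈ Finset.range n, (1 - decay m x s)) ^ 2 := by
  have h := exp_le_prod_decay_small hm hx n
  rwa [Finset.filter_true_of_mem fun s _ => (decay_le hx s).trans_lt hxm, Finset.prod_pow] at h

/-! ### Noise accumulated along one eigendirection -/

/-- Noise of variance `a` per unit stepsize accumulated by the recursion
`s ↦ (1 - γ_t a)² s + γ_t² a`. -/
noncomputable def accum (γ : ℕ → ℝ) (a : ℝ) : ℕ → ℝ
  | 0 => 0
  | t + 1 => (1 - γ t * a) ^ 2 * accum γ a t + γ t ^ 2 * a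

/-- The level `x / 4` lies below the equilibrium, so it is never lost once reached. Below it, one
step adds at least `x² - 2x · x/4 = x² / 2`. -/
lemma accum_const_ge {γ : ℕ → ℝ} {x : ℝ} (hx : 0 ≤ x) {n : ℕ}
    (hγ : ∀ t < n, γ t = x) : min (x / 4) (n * x ^ 2 / 2) ≤ accum γ 1 n := by
  induction n with
  | zero => simp [accum]
  | succ n ih =>
    have ih' := ih fun t ht => hγ t (by omega)
    have hsq : 0 ≤ (1 - x) ^ 2 := sq_nonneg _
    simp only [accum, hγ n (by omega), mul_one]
    rcases le_total (x / 4) (accum γ 1 n) with h | h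
    · refine (min_le_left _ _).trans ?_
      nlinarith [mul_le_mul_of_nonneg_left h hsq, mul_nonneg hx hx, mul_nonneg (mul_nonneg hx hx) hx]
    · rcases le_or_gt (n * x ^ 2 / 2) (accum γ 1 n) with h2 | h2
      · refine (min_le_right _ _).trans ?_
        push_cast
        have h0 : 0 ≤ accum γ 1 n := le_trans (by positivity) h2
        nlinarith [mul_nonneg (mul_nonneg hx hx) h0, mul_le_mul_of_nonneg_left h hx]
      · have h3 : x / 4 ≤ accum γ 1 n := (min_le_iff.1 ih').resolve_right (not_le.2 h2)
        refine (min_le_left _ _).trans ?_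
        nlinarith [mul_le_mul_of_nonneg_left h3 hsq, mul_nonneg hx hx,
          mul_nonneg (mul_nonneg hx hx) hx]

/-- Below `x / 2` the injected `x²` outweighs the loss `2xy`; from above, a step cannot fall under
`x / 2`. Large steps therefore cannot destroy noise of order `1 / m`. -/
lemma accum_step_ge {x y : ℝ} (hx : 0 ≤ x) (hy : 0 ≤ y) :
    min y (x / 2) ≤ (1 - x) ^ 2 * y + x ^ 2 := by
  have hsq : 0 ≤ (1 - x) ^ 2 := sq_nonneg _
  rcases le_total y (x / 2) with h | h
  · refine (min_le_left _ _).trans ?_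
    nlinarith [mul_le_mul_of_nonneg_left h hx, mul_nonneg (mul_nonneg hx hx) hy]
  · refine (min_le_right _ _).trans ?_
    nlinarith [mul_le_mul_of_nonneg_left h hsq, mul_nonneg (mul_nonneg hx hx) hx]

lemma accum_nonneg {γ : ℕ → ℝ} {a : ℝ} (ha : 0 ≤ a) (n : ℕ) : 0 ≤ accum γ a n := by
  induction n with
  | zero => simp [accum]
  | succ n ih => simp only [accum]; positivity

/-- Rescaling reduces every eigenvalue to `a = 1` with stepsizes `γ_t a`. -/
lemma accum_mul (γ : ℕ → ℝ) (a : ℝ) (n : ℕ) :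
    a * accum γ a n = accum (fun t => γ t * a) 1 n := by
  induction n with
  | zero => simp [accum]
  | succ n ih => simp only [accum, ← ih]; ring

/-- The first `⌈m⌉` steps have constant stepsize and reach `r`. Later steps of size at least `1 / m`
keep any level up to `1 / (2m) ≥ r`; each smaller step costs at most its factor `(1 - γ_s)²`, and
these factors multiply to at least `exp (-9)`. -/
lemma accum_decay_one_ge {m x : ℝ} (hm : 10 ≤ m) (hx : 0 ≤ x) (hx1 : x ≤ 1) {n : ℕ}
    (hn : m ≤ n) :
    Real.exp (-9) / 4 * min (1 / m) (m * x ^ 2) ≤ accum (decay m x) 1 n := by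
  have hm0 : 0 < m := by linarith
  set r := min (1 / m) (m * x ^ 2) / 4 with hr
  have hr0 : 0 ≤ r := by positivity
  obtain ⟨k, rfl⟩ := Nat.exists_eq_add_of_le (Nat.ceil_le.2 hn)
  have hbase : r ≤ accum (decay m x) 1 ⌈m⌉₊ := by
    have h := accum_const_ge (γ := decay m x) hx (n := ⌈m⌉₊)
      fun t ht => decay_eq_of_lt hm0 (Nat.lt_ceil.1 ht)
    refine le_trans ?_ h
    have hc := Nat.le_ceil m
    rw [hr, le_min_iff]
    constructor
    · rcases le_total (1 / m) x with h | h
      · linarith [min_le_left (1 / m) (m * x ^ 2)]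
      · have : m * x ≤ 1 := by rwa [le_div_iff₀' hm0] at h
        have := mul_le_mul_of_nonneg_right this hx
        nlinarith [min_le_right (1 / m) (m * x ^ 2)]
    · have := mul_le_mul_of_nonneg_right hc (sq_nonneg x)
      have h0 : 0 ≤ m * x ^ 2 := by positivity
      linarith [min_le_right (1 / m) (m * x ^ 2)]
  have key : ∀ k : ℕ, r * ∏ s ∈ Finset.range (⌈m⌉₊ + k) with decay m x s < 1 / m,
      (1 - decay m x s) ^ 2 ≤ accum (decay m x) 1 (⌈m⌉₊ + k) := by
    have hle1 : ∀ n, ∏ s ∈ Finset.range n with decay m x s < 1 / m, (1 - decay m x s) ^ 2 ≤ 1 := by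
      intro n
      refine Finset.prod_le_one (fun _ _ => sq_nonneg _) fun s _ => ?_
      have h1 := decay_nonneg (m := m) hx s
      have h2 := decay_le (m := m) hx s
      exact pow_le_one₀ (by linarith) (by linarith)
    intro k
    induction k with
    | zero => exact (mul_le_of_le_one_right hr0 (hle1 _)).trans hbase
    | succ k ih =>
      rw [← add_assoc, Finset.range_add_one, Finset.filter_insert]
      simp only [accum, mul_one]
      split_ifs with hlt
      · rw [Finset.prod_insert (by simp)]
        nlinarith [mul_le_mul_of_nonneg_left ih (sq_nonneg (1 - decay m x (⌈m⌉₊ + k))),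
          sq_nonneg (decay m x (⌈m⌉₊ + k))]
      · refine le_trans ?_ (accum_step_ge (decay_nonneg hx _)
          (accum_nonneg zero_le_one _))
        rw [le_min_iff]
        refine ⟨ih, (mul_le_of_le_one_right hr0 (hle1 _)).trans ?_⟩
        have h4 := min_le_left (1 / m) (m * x ^ 2)
        have h5 : 0 < 1 / m := by positivity
        linarith
  have h := exp_le_prod_decay_small hm hx (⌈m⌉₊ + k)
  calc _ = r * Real.exp (-9) := by rw [hr]; ring
    _ ≤ _ := (mul_le_mul_of_nonneg_left h hr0).trans (key k)

/-- After one phase the accumulated noise is at least of order `1 / (m a)` for `a ≥ 1 / (g m)`, and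
of order `m g² a` otherwise. -/
lemma accum_decay_ge {m g a : ℝ} (hm : 10 ≤ m) (hg : 0 < g) (ha : 0 ≤ a) (hga : g * a ≤ 1) {n : ℕ}
    (hn : m ≤ n) :
    Real.exp (-9) / 4 / m * (if 1 / (g * m) ≤ a then a⁻¹ else (m * g) ^ 2 * a)
      ≤ accum (decay m g) a n := by
  have hm0 : 0 < m := by linarith
  rcases ha.eq_or_lt with rfl | ha
  · simp [accum_nonneg le_rfl]
  have h := accum_decay_one_ge hm (mul_nonneg hg.le ha.le) hga hn
  have h2 : accum (decay m (g * a)) 1 n = a * accum (decay m g) a n := by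
    rw [accum_mul]; congr 1; ext t; rw [decay_mul]
  rw [h2] at h
  have hiff : 1 / (g * m) ≤ a ↔ 1 ≤ m * (g * a) := by
    rw [div_le_iff₀ (by positivity)]; constructor <;> intro h <;> linarith
  rw [← mul_le_mul_iff_right₀ ha]
  refine le_trans (le_of_eq ?_) h
  split_ifs with hc
  · rw [hiff] at hc
    rw [min_eq_left]
    · field_simp
    · rw [div_le_iff₀ hm0]; nlinarith
  · rw [hiff, not_le] at hc
    rw [min_eq_right]
    · field_simp
    · rw [le_div_iff₀ hm0]
      have : 0 ≤ m * (g * a) := by positivity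
      nlinarith

/-- Guarantees that a phase is long enough to contain its whole initial stretch of constant
stepsize. -/
lemma le_of_ten_le_nEff {n : ℕ} (h : 10 ≤ nEff n) : nEff n ≤ n := by
  unfold nEff at *
  have hn : 3 ≤ n := by
    by_contra hn
    have : n = 0 ∨ n = 1 ∨ n = 2 := by omega
    -- For `n = 0, 1` the logarithm is zero and division by zero returns `0`; for `n = 2` the
    -- quotient is below `10`.
    rcases this with rfl | rfl | rfl
    · norm_num at h
    · norm_num at h
    · have := Real.log_two_gt_d9
      rw [Nat.cast_ofNat, le_div_iff₀ (by linarith)] at h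
      linarith
  refine div_le_self (by positivity) ?_
  rw [Real.le_log_iff_exp_le (by positivity)]
  have : (3 : ℝ) ≤ n := by exact_mod_cast hn
  linarith [Real.exp_one_lt_d9]

end CovShift

namespace CovShift

variable {E : Type*} [NormedAddCommGroup E] [InnerProductSpace ℝ E]

/-! ### The Loewner order -/

@[simp] lemma outer_apply (x y : E) : outer x y = ⟪x, y⟫ • x := rfl

lemma inner_outer (x a : E) : ⟪a, outer x a⟫ = ⟪x, a⟫ ^ 2 := by
  rw [outer_apply, inner_smul_right, real_inner_comm, sq]

lemma outer_isPositive (x : E) : (outer x).IsPositive := by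
  refine ContinuousLinearMap.isPositive_def.2 ⟨fun y z => ?_, fun y => ?_⟩
  · simp only [ContinuousLinearMap.coe_coe, outer_apply, inner_smul_left, inner_smul_right,
      RCLike.conj_to_real]
    rw [real_inner_comm y x]; ring
  · rw [ContinuousLinearMap.reApplyInnerSelf_apply, outer_apply, inner_smul_left, RCLike.conj_to_real]
    exact mul_self_nonneg _

lemma loewner_add {A B C D : E →L[ℝ] E} (h : A ≤ B) (h' : C ≤ D) : A + C ≤ B + D := by
  rw [ContinuousLinearMap.le_def] at *
  simpa [add_sub_add_comm] using h.add h'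

lemma loewner_smul_left {A : E →L[ℝ] E} {c d : ℝ} (hcd : c ≤ d) (h : A.IsPositive) :
    c • A ≤ d • A := by
  rw [ContinuousLinearMap.le_def, ← sub_smul]
  exact h.smul_of_nonneg (sub_nonneg.2 hcd)

lemma loewner_le_add {A B : E →L[ℝ] E} (h : B.IsPositive) : A ≤ A + B := by
  rwa [ContinuousLinearMap.le_def, add_sub_cancel_left]

lemma isPositive_of_le {A B : E →L[ℝ] E} (hA : A.IsPositive) (h : A ≤ B) : B.IsPositive := by
  rw [← ContinuousLinearMap.nonneg_iff_isPositive] at *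
  exact hA.trans h

lemma inner_le_of_loewner {A B : E →L[ℝ] E} (h : A ≤ B) (x : E) : ⟪x, A x⟫ ≤ ⟪x, B x⟫ := by
  have := ((ContinuousLinearMap.le_def _ _).1 h).inner_nonneg_right x
  rw [sub_apply, inner_sub_right] at this
  linarith

lemma isPositive_conj {A T : E →L[ℝ] E} (hT : ∀ x y, ⟪T x, y⟫ = ⟪x, T y⟫) (hA : A.IsPositive) :
    (T * A * T).IsPositive := by
  refine ContinuousLinearMap.isPositive_def.2 ⟨fun y z => ?_, fun y => ?_⟩
  · simp only [ContinuousLinearMap.coe_coe, mul_apply_eq_comp]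
    rw [hT, hA.inner_left_eq_inner_right, hT]
  · simp only [ContinuousLinearMap.reApplyInnerSelf_apply, mul_apply_eq_comp, hT]
    exact hA.inner_nonneg_left _

lemma loewner_conj {A B T : E →L[ℝ] E} (hT : ∀ x y, ⟪T x, y⟫ = ⟪x, T y⟫) (h : A ≤ B) :
    T * A * T ≤ T * B * T := by
  rw [ContinuousLinearMap.le_def] at *
  rw [← sub_mul, ← mul_sub]
  exact isPositive_conj hT h

lemma conj_outer {T : E →L[ℝ] E} (hT : ∀ x y, ⟪T x, y⟫ = ⟪x, T y⟫) (w : E) :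
    T * outer w * T = outer (T w) := by
  ext x
  simp [hT]

/-! ### Operators that are diagonal in a Hilbert basis -/

variable {ι : Type*} {b : HilbertBasis ι ℝ E} {S T : E →L[ℝ] E} {f g : ι → ℝ}

lemma inner_basis_self (b : HilbertBasis ι ℝ E) (i : ι) : ⟪b i, b i⟫ = 1 := by
  rw [real_inner_self_eq_norm_sq, b.orthonormal.norm_eq_one, one_pow]

lemma inner_basis_ne (b : HilbertBasis ι ℝ E) {i j : ι} (h : i ≠ j) : ⟪b i, b j⟫ = 0 :=
  b.orthonormal.inner_eq_zero h

namespace IsEigenbasis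

/-- Expand `x` in the basis and apply `T` termwise by continuity. Symmetry, positivity and order
comparisons all follow coordinatewise from this expansion. -/
lemma hasSum (hT : IsEigenbasis T b f) (x y : E) :
    HasSum (fun i => f i * (⟪b i, x⟫ * ⟪b i, y⟫)) ⟪T x, y⟫ := by
  rw [real_inner_comm]
  have h := ((b.hasSum_repr x).mapL T).mapL (innerSL ℝ y)
  rw [innerSL_apply_apply] at h
  have hterm : (fun i => innerSL ℝ y (T (b.repr x i • b i)))
      = fun i => f i * (⟪b i, x⟫ * ⟪b i, y⟫) := by
    funext i
    simp only [map_smul, hT i, innerSL_apply_apply, b.repr_apply_apply, smul_eq_mul]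
    rw [real_inner_comm y (b i)]; ring
  rwa [hterm] at h

lemma symm (hT : IsEigenbasis T b f) (x y : E) : ⟪T x, y⟫ = ⟪x, T y⟫ := by
  rw [real_inner_comm (T y) x]
  refine (hT.hasSum x y).unique ?_
  convert hT.hasSum y x using 2 with i
  ring

lemma hasSum_sq (hT : IsEigenbasis T b f) (x : E) :
    HasSum (fun i => f i * ⟪b i, x⟫ ^ 2) ⟪x, T x⟫ := by
  rw [← hT.symm]
  convert hT.hasSum x x using 2 with i
  ring

lemma one : IsEigenbasis (1 : E →L[ℝ] E) b fun _ => 1 := fun i => by simp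

lemma zero : IsEigenbasis (0 : E →L[ℝ] E) b fun _ => 0 := fun i => by simp

lemma add (hS : IsEigenbasis S b f) (hT : IsEigenbasis T b g) :
    IsEigenbasis (S + T) b fun i => f i + g i := fun i => by
  simp [hS i, hT i, add_smul]

lemma sub (hS : IsEigenbasis S b f) (hT : IsEigenbasis T b g) :
    IsEigenbasis (S - T) b fun i => f i - g i := fun i => by
  simp [hS i, hT i, sub_smul]

lemma smul (c : ℝ) (hS : IsEigenbasis S b f) : IsEigenbasis (c • S) b fun i => c * f i := fun i => by
  simp [hS i, mul_smul]

lemma mul (hS : IsEigenbasis S b f) (hT : IsEigenbasis T b g) :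
    IsEigenbasis (S * T) b fun i => f i * g i := fun i => by
  rw [mul_apply_eq_comp, hT i, map_smul, hS i, smul_smul, mul_comm]

lemma isPositive (hT : IsEigenbasis T b f) (hf : ∀ i, 0 ≤ f i) : T.IsPositive := by
  refine ContinuousLinearMap.isPositive_def.2 ⟨hT.symm, fun x => ?_⟩
  rw [ContinuousLinearMap.reApplyInnerSelf_apply, hT.symm]
  exact (hT.hasSum_sq x).nonneg fun i => mul_nonneg (hf i) (sq_nonneg _)

lemma le (hS : IsEigenbasis S b f) (hT : IsEigenbasis T b g) (h : ∀ i, f i ≤ g i) : S ≤ T :=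
  (ContinuousLinearMap.le_def _ _).2 ((hT.sub hS).isPositive fun i => sub_nonneg.2 (h i))

/-- Serves to prove that operators diagonal in the same basis commute. -/
lemma unique (hS : IsEigenbasis S b f) (hT : IsEigenbasis T b f) : S = T :=
  le_antisymm (hS.le hT fun _ => le_rfl) (hT.le hS fun _ => le_rfl)

lemma contraction (hT : IsEigenbasis T b f) (γ : ℕ → ℝ) (s n : ℕ) :
    IsEigenbasis (contraction γ T s n) b fun i => ∏ t ∈ Finset.range n, (1 - γ (s + t) * f i) := by
  induction n with
  | zero => simpa [CovShift.contraction] using one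
  | succ n ih =>
    have h := ih.mul (one.sub (hT.smul (γ (s + n))))
    simpa [CovShift.contraction, List.range_succ, Finset.prod_range_succ] using h

lemma eigenvalue_le_norm (hT : IsEigenbasis T b f) (i : ι) : f i ≤ ‖T‖ := by
  have h := T.le_opNorm (b i)
  rw [hT i, norm_smul, b.orthonormal.norm_eq_one, mul_one, mul_one] at h
  exact (le_abs_self _).trans h

lemma eigenvalue_eq (hT : IsEigenbasis T b f) (i : ι) : f i = ⟪b i, T (b i)⟫ := by
  rw [hT i, inner_smul_right, inner_basis_self, mul_one]

end IsEigenbasis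

lemma contraction_congr {γ γ' : ℕ → ℝ} {s s' n : ℕ} (h : ∀ t < n, γ (s + t) = γ' (s' + t))
    (A : E →L[ℝ] E) : contraction γ A s n = contraction γ' A s' n := by
  unfold contraction
  congr 1
  refine List.map_congr_left fun t ht => ?_
  rw [h t (List.mem_range.1 ht)]

lemma contraction_succ (γ : ℕ → ℝ) (A : E →L[ℝ] E) (s n : ℕ) :
    contraction γ A s (n + 1) = contraction γ A s n * (1 - γ (s + n) • A) := by
  simp [contraction, List.range_succ]

lemma summable_smul_outer [CompleteSpace E] (b : HilbertBasis ι ℝ E) {U : Set ι}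
    (hf : Summable fun i : U => f i) : Summable fun i : U => f i • outer (b i) := by
  refine Summable.of_norm ?_
  have : (fun i : U => ‖f i • outer (b i)‖) = fun i : U => |f i| := by
    ext i
    rw [norm_smul, outer, InnerProductSpace.norm_rankOne, b.orthonormal.norm_eq_one]
    simp
  rw [this]
  exact hf.abs

/-- Summability makes the series converge in operator norm (otherwise `tsum` would default to `0`),
so it may be evaluated termwise at `b j`. -/
lemma specPart_isEigenbasis [CompleteSpace E] (b : HilbertBasis ι ℝ E) {U : Set ι}
    (hf : Summable fun i : U => f i) : IsEigenbasis (specPart b f U) b (U.indicator f) := by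
  intro j
  have h := (summable_smul_outer b hf).hasSum.mapL (ContinuousLinearMap.apply ℝ E (b j))
  refine h.unique ?_
  simp only [ContinuousLinearMap.apply_apply, smul_apply, outer_apply]
  by_cases hj : j ∈ U
  · convert hasSum_single (⟨j, hj⟩ : U) fun i hi => ?_ using 1
    · rw [inner_basis_self]; simp [hj]
    · rw [inner_basis_ne b fun h => hi (Subtype.ext h)]
      simp
  · rw [Set.indicator_of_notMem hj, zero_smul]
    convert hasSum_zero using 2 with i
    have hij : (i : ι) ≠ j := fun h => hj (h ▸ i.2)
    rw [inner_basis_ne b hij]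
    simp

/-! ### The functional `A ↦ tr (T A)` for a trace class operator `T` -/

lemma trace_mul_eq (hT : IsEigenbasis T b f) (A : E →L[ℝ] E) :
    trace b (T * A) = ∑' i, f i * ⟪b i, A (b i)⟫ := by
  unfold trace
  refine tsum_congr fun i => ?_
  rw [mul_apply_eq_comp, ← hT.symm, hT i, inner_smul_left, RCLike.conj_to_real]

lemma summable_trace (b : HilbertBasis ι ℝ E) (hf : Summable f) (A : E →L[ℝ] E) :
    Summable fun i => f i * ⟪b i, A (b i)⟫ := by
  refine Summable.of_norm_bounded (hf.abs.mul_right ‖A‖) fun i => ?_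
  rw [Real.norm_eq_abs, abs_mul]
  refine mul_le_mul_of_nonneg_left ?_ (abs_nonneg _)
  refine (abs_real_inner_le_norm _ _).trans ?_
  have := A.le_opNorm (b i)
  rw [b.orthonormal.norm_eq_one] at *
  linarith

lemma trace_mul_mono (hT : IsEigenbasis T b f) (hf : Summable f) (hf0 : ∀ i, 0 ≤ f i)
    {A B : E →L[ℝ] E} (h : A ≤ B) : trace b (T * A) ≤ trace b (T * B) := by
  rw [trace_mul_eq hT, trace_mul_eq hT]
  exact (summable_trace b hf A).tsum_le_tsum
    (fun i => mul_le_mul_of_nonneg_left (inner_le_of_loewner h _) (hf0 i)) (summable_trace b hf B)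

lemma trace_mul_nonneg (hT : IsEigenbasis T b f) (hf0 : ∀ i, 0 ≤ f i) {A : E →L[ℝ] E}
    (h : A.IsPositive) : 0 ≤ trace b (T * A) := by
  rw [trace_mul_eq hT]
  exact tsum_nonneg fun i => mul_nonneg (hf0 i) (h.inner_nonneg_right _)

lemma trace_mul_add (hT : IsEigenbasis T b f) (hf : Summable f) (A B : E →L[ℝ] E) :
    trace b (T * (A + B)) = trace b (T * A) + trace b (T * B) := by
  rw [trace_mul_eq hT, trace_mul_eq hT, trace_mul_eq hT,
    ← (summable_trace b hf A).tsum_add (summable_trace b hf B)]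
  refine tsum_congr fun i => ?_
  rw [add_apply, inner_add_right, mul_add]

lemma trace_mul_smul (hT : IsEigenbasis T b f) (c : ℝ) (A : E →L[ℝ] E) :
    trace b (T * c • A) = c * trace b (T * A) := by
  rw [trace_mul_eq hT, trace_mul_eq hT, ← tsum_mul_left]
  refine tsum_congr fun i => ?_
  rw [smul_apply, inner_smul_right]; ring

lemma trace_mul_outer (hT : IsEigenbasis T b f) (w : E) :
    trace b (T * outer w) = sqNorm T w := by
  rw [trace_mul_eq hT, sqNorm, ← (hT.hasSum_sq w).tsum_eq]
  refine tsum_congr fun i => ?_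
  rw [inner_outer, real_inner_comm]

/-- Cyclicity of the trace, read off entry by entry because `S` and `T` share the basis; `A` is
arbitrary. It turns the conjugation by the target contraction into the squared product in
`dEffFinetune`. -/
lemma trace_mul_conj (hT : IsEigenbasis T b f) (hS : IsEigenbasis S b g) (A : E →L[ℝ] E) :
    trace b (T * (S * A * S)) = trace b (S ^ 2 * T * A) := by
  rw [trace_mul_eq hT, trace_mul_eq ((sq S ▸ hS.mul hS).mul hT)]
  refine tsum_congr fun i => ?_
  simp only [mul_apply_eq_comp]
  rw [← hS.symm, hS i, map_smul, inner_smul_left, inner_smul_right, RCLike.conj_to_real]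
  ring

/-! ### Effective dimensions -/

/-- `T_U⁻¹ + a² T_{Uᶜ}`. -/
noncomputable def rateOp (b : HilbertBasis ι ℝ E) (f : ι → ℝ) (U : Set ι) (a : ℝ) : E →L[ℝ] E :=
  specPart b (fun i => (f i)⁻¹) U + a ^ 2 • specPart b f Uᶜ

lemma finite_setOf_le (hf : Summable f) {r : ℝ} (hr : 0 < r) : {i | r ≤ f i}.Finite := by
  have h := hf.tendsto_cofinite_zero.eventually_lt_const hr
  rw [Filter.eventually_cofinite] at h
  simpa using h

/-- Summable eigenvalues leave only finitely many above `r`, so the sum of inverses over the head is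
finite. -/
lemma rateOp_isEigenbasis [CompleteSpace E] (hf : Summable f) {r : ℝ} (hr : 0 < r)
    (b : HilbertBasis ι ℝ E) (a : ℝ) [DecidablePred fun i => r ≤ f i] :
    IsEigenbasis (rateOp b f {i | r ≤ f i} a) b
      fun i => if r ≤ f i then (f i)⁻¹ else a ^ 2 * f i := by
  have := (finite_setOf_le hf hr).to_subtype
  have h1 := specPart_isEigenbasis b (f := fun i => (f i)⁻¹) (U := {i | r ≤ f i})
    (summable_of_hasFiniteSupport (Set.toFinite _))
  have h2 := specPart_isEigenbasis b (f := f) (U := {i | r ≤ f i}ᶜ) (hf.subtype _)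
  have h := h1.add (h2.smul (a ^ 2))
  convert h using 1
  · rfl
  funext i
  by_cases hi : r ≤ f i <;> simp [hi]

/-- Head directions contribute `f i · (f i)⁻¹ = 1` each, tail directions `a² (f i)²`. -/
lemma trace_mul_rateOp [CompleteSpace E] (hT : IsEigenbasis T b f) (hf : Summable f) {r : ℝ}
    (hr : 0 < r) (a : ℝ) :
    trace b (T * rateOp b f {i | r ≤ f i} a) = dEff f {i | r ≤ f i} a := by
  classical
  have hfin := finite_setOf_le hf hr
  have := hfin.fintype
  have hE := rateOp_isEigenbasis hf hr b a
  set U : Set ι := {i | r ≤ f i} with hU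
  have hs : Summable fun i => f i * ⟪b i, rateOp b f U a (b i)⟫ := summable_trace b hf _
  rw [trace_mul_eq hT, ← hs.tsum_subtype_add_tsum_subtype_compl U, dEff, ← tsum_mul_left]
  congr 1
  · rw [tsum_fintype, Set.ncard_eq_toFinset_card' U, Finset.sum_congr rfl (g := fun _ => (1 : ℝ))]
    · simp
    · rintro ⟨i, hi⟩ -
      have hi' : r ≤ f i := hi
      simp only
      rw [← hE.eigenvalue_eq, if_pos hi', mul_inv_cancel₀ (by linarith)]
  · refine tsum_congr fun ⟨i, hi⟩ => ?_
    have hi' : ¬ r ≤ f i := hi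
    simp only
    rw [← hE.eigenvalue_eq, if_neg hi']
    ring

end CovShift

namespace CovShift

/-! ### Moments of the data distributions -/

lemma inner_integral_apply {E α : Type*} [NormedAddCommGroup E] [InnerProductSpace ℝ E]
    [CompleteSpace E] [MeasurableSpace α] {ρ : Measure α} {F : α → E →L[ℝ] E}
    (hF : Integrable F ρ) (a c : E) : ⟪a, (∫ z, F z ∂ρ) c⟫ = ∫ z, ⟪a, F z c⟫ ∂ρ := by
  have := ((innerSL ℝ a).comp (ContinuousLinearMap.apply ℝ E c)).integral_comp_comm hF
  simpa using this.symm

variable {E : Type*} [NormedAddCommGroup E] [InnerProductSpace ℝ E] [CompleteSpace E]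
  [SecondCountableTopology E] [MeasurableSpace E] [BorelSpace E]
  {D : Measure (E × ℝ)} [IsProbabilityMeasure D] {ι : Type*} {b : HilbertBasis ι ℝ E} {μ : ι → ℝ}
  {β σ : ℝ} {wstar : E}

lemma norm_outer {E : Type*} [NormedAddCommGroup E] [InnerProductSpace ℝ E] (x : E) :
    ‖outer x‖ = ‖x‖ ^ 2 := by
  rw [outer, InnerProductSpace.norm_rankOne, sq]

lemma continuous_outer {E : Type*} [NormedAddCommGroup E] [InnerProductSpace ℝ E] :
    Continuous (outer : E → E →L[ℝ] E) := by
  have h2 : Continuous fun p : E × E => InnerProductSpace.rankOne ℝ p.1 p.2 := by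
    simp_rw [InnerProductSpace.rankOne_def]
    fun_prop
  exact h2.comp (continuous_id.prodMk continuous_id)

lemma integrable_norm_sq (h4 : Integrable (fun z : E × ℝ => ‖z.1‖ ^ 4) D) :
    Integrable (fun z : E × ℝ => ‖z.1‖ ^ 2) D := by
  refine ((integrable_const (1 : ℝ)).add h4).mono' (by fun_prop) (ae_of_all _ fun z => ?_)
  rw [Real.norm_of_nonneg (by positivity)]
  simp only [Pi.add_apply]
  nlinarith [sq_nonneg (‖z.1‖ ^ 2 - 1)]

lemma integrable_outer (h4 : Integrable (fun z : E × ℝ => ‖z.1‖ ^ 4) D) :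
    Integrable (fun z : E × ℝ => outer z.1) D := by
  refine (integrable_norm_sq h4).mono' ?_ (ae_of_all _ fun z => (norm_outer z.1).le)
  exact (continuous_outer.comp continuous_fst).aestronglyMeasurable

lemma integrable_outer_mul_mul (h4 : Integrable (fun z : E × ℝ => ‖z.1‖ ^ 4) D) (A : E →L[ℝ] E) :
    Integrable (fun z : E × ℝ => outer z.1 * A * outer z.1) D := by
  refine (h4.mul_const ‖A‖).mono' ?_ (ae_of_all _ fun z => ?_)
  · have := continuous_outer.comp (continuous_fst (X := E) (Y := ℝ))
    exact ((this.mul continuous_const).mul this).aestronglyMeasurable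
  · refine (norm_mul_le _ _).trans ((mul_le_mul_of_nonneg_right (norm_mul_le _ _)
      (norm_nonneg _)).trans (le_of_eq ?_))
    rw [norm_outer]; ring

lemma inner_covOp (h4 : Integrable (fun z : E × ℝ => ‖z.1‖ ^ 4) D) (a c : E) :
    ⟪a, covOp D c⟫ = ∫ z, ⟪z.1, c⟫ * ⟪a, z.1⟫ ∂D := by
  rw [covOp, inner_integral_apply (integrable_outer h4)]
  simp [inner_smul_right]

lemma inner_covOp_self (h4 : Integrable (fun z : E × ℝ => ‖z.1‖ ^ 4) D) (a : E) :
    ⟪a, covOp D a⟫ = ∫ z, ⟪z.1, a⟫ ^ 2 ∂D := by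
  rw [inner_covOp h4]
  refine integral_congr_ae (ae_of_all _ fun z => ?_)
  simp only [real_inner_comm z.1 a, sq]

lemma integrable_inner_sq (h4 : Integrable (fun z : E × ℝ => ‖z.1‖ ^ 4) D) (a : E) :
    Integrable (fun z : E × ℝ => ⟪z.1, a⟫ ^ 2) D := by
  refine ((integrable_norm_sq h4).mul_const (‖a‖ ^ 2)).mono' (by fun_prop) (ae_of_all _ fun z => ?_)
  rw [Real.norm_of_nonneg (by positivity), ← mul_pow, sq_le_sq, abs_mul, abs_norm, abs_norm]
  exact abs_real_inner_le_norm _ _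

lemma eigenvalue_nonneg (h4 : Integrable (fun z : E × ℝ => ‖z.1‖ ^ 4) D)
    (he : IsEigenbasis (covOp D) b μ) (i : ι) : 0 ≤ μ i := by
  rw [he.eigenvalue_eq, inner_covOp_self h4]
  exact integral_nonneg fun z => sq_nonneg _

/-- Bessel's inequality under the integral bounds all partial sums by `𝔼‖x‖²`: the covariance is
trace class. -/
lemma summable_eigenvalue (h4 : Integrable (fun z : E × ℝ => ‖z.1‖ ^ 4) D)
    (he : IsEigenbasis (covOp D) b μ) : Summable μ := by
  refine summable_of_sum_le (c := ∫ z, ‖z.1‖ ^ 2 ∂D) (eigenvalue_nonneg h4 he) fun u => ?_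
  simp_rw [he.eigenvalue_eq, inner_covOp_self h4]
  rw [← integral_finsetSum _ fun i _ => integrable_inner_sq h4 _]
  refine integral_mono (integrable_finsetSum _ fun i _ => integrable_inner_sq h4 _)
    (integrable_norm_sq h4) fun z => ?_
  refine le_trans (le_of_eq ?_) (b.orthonormal.sum_inner_products_le z.1 (s := u))
  refine Finset.sum_congr rfl fun i _ => ?_
  rw [real_inner_comm, Real.norm_eq_abs, sq_abs]

/-! ### Label noise -/

lemma integral_noise (h : WellSpecified D wstar σ) : ∫ z, (z.2 - ⟪wstar, z.1⟫) ∂D = 0 :=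
  h.noise_law.integral_eq.trans integral_id_gaussianReal

lemma memLp_noise (h : WellSpecified D wstar σ) :
    MemLp (fun z : E × ℝ => z.2 - ⟪wstar, z.1⟫) 2 D := by
  have h1 : MemLp id 2 (D.map fun z : E × ℝ => z.2 - ⟪wstar, z.1⟫) := by
    rw [h.noise_law.map_eq]; exact memLp_id_gaussianReal 2
  exact h1.comp_of_map h.noise_law.aemeasurable

lemma integral_noise_sq (h : WellSpecified D wstar σ) :
    ∫ z, (z.2 - ⟪wstar, z.1⟫) ^ 2 ∂D = σ ^ 2 := by
  have h1 := h.noise_law.variance_eq.trans variance_id_gaussianReal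
  rw [variance_eq_integral h.noise_law.aemeasurable, integral_noise h] at h1
  simp only [sub_zero] at h1
  exact h1

lemma noise_indep_comp (h : WellSpecified D wstar σ) {φ : E → ℝ} (hφ : Measurable φ) {ψ : ℝ → ℝ}
    (hψ : Measurable ψ) :
    IndepFun (fun z : E × ℝ => φ z.1) (fun z : E × ℝ => ψ (z.2 - ⟪wstar, z.1⟫)) D :=
  h.noise_indep.comp hφ hψ

/-- The noise is centred and independent of the covariates. -/
lemma integral_mul_noise (h : WellSpecified D wstar σ) {φ : E → ℝ} (hφ : Measurable φ) :
    ∫ z, φ z.1 * (z.2 - ⟪wstar, z.1⟫) ∂D = 0 := by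
  refine ((noise_indep_comp h hφ measurable_id).integral_fun_mul_eq_mul_integral
    (hφ.comp measurable_fst).aestronglyMeasurable (by fun_prop)).trans ?_
  simp [integral_noise h]

lemma integral_mul_noise_sq (h : WellSpecified D wstar σ) {φ : E → ℝ} (hφ : Measurable φ) :
    ∫ z, φ z.1 * (z.2 - ⟪wstar, z.1⟫) ^ 2 ∂D = (∫ z, φ z.1 ∂D) * σ ^ 2 := by
  refine ((noise_indep_comp h hφ (measurable_id.pow_const 2)).integral_fun_mul_eq_mul_integral
    (hφ.comp measurable_fst).aestronglyMeasurable (by fun_prop)).trans ?_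
  simp [integral_noise_sq h]

lemma integrable_mul_noise (h : WellSpecified D wstar σ) {φ : E → ℝ} (hφ : Measurable φ)
    (hi : Integrable (fun z : E × ℝ => φ z.1) D) :
    Integrable (fun z : E × ℝ => φ z.1 * (z.2 - ⟪wstar, z.1⟫)) D :=
  (noise_indep_comp h hφ measurable_id).integrable_mul hi
    ((memLp_noise h).integrable (by norm_num))

lemma integrable_mul_noise_sq (h : WellSpecified D wstar σ) {φ : E → ℝ} (hφ : Measurable φ)
    (hi : Integrable (fun z : E × ℝ => φ z.1) D) :
    Integrable (fun z : E × ℝ => φ z.1 * (z.2 - ⟪wstar, z.1⟫) ^ 2) D :=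
  (noise_indep_comp h hφ (measurable_id.pow_const 2)).integrable_mul hi (memLp_noise h).integrable_sq

lemma integrable_noise_smul_outer (h : WellSpecified D wstar σ)
    (h4 : Integrable (fun z : E × ℝ => ‖z.1‖ ^ 4) D) :
    Integrable (fun z : E × ℝ => (z.2 - ⟪wstar, z.1⟫) ^ 2 • outer z.1) D := by
  refine (integrable_mul_noise_sq h (φ := fun x => ‖x‖ ^ 2) (by fun_prop)
    (integrable_norm_sq h4)).mono' ?_ (ae_of_all _ fun z => ?_)
  · have := continuous_outer.comp (continuous_fst (X := E) (Y := ℝ))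
    have h2 : Continuous fun z : E × ℝ => (z.2 - ⟪wstar, z.1⟫) ^ 2 := by fun_prop
    exact (h2.smul this).aestronglyMeasurable
  · rw [norm_smul, norm_outer, Real.norm_of_nonneg (by positivity), mul_comm]

lemma noiseOp_eq (h : WellSpecified D wstar σ) (h4 : Integrable (fun z : E × ℝ => ‖z.1‖ ^ 4) D) :
    noiseOp D wstar = σ ^ 2 • covOp D := by
  ext c
  refine ext_inner_left ℝ fun a => ?_
  rw [noiseOp, inner_integral_apply (integrable_noise_smul_outer h h4), smul_apply, inner_smul_right,
    inner_covOp h4, mul_comm, ← integral_mul_noise_sq h (φ := fun x => ⟪x, c⟫ * ⟪a, x⟫) (by fun_prop)]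
  refine integral_congr_ae (ae_of_all _ fun z => ?_)
  simp only [smul_apply, outer_apply, inner_smul_right]
  ring

/-- The excess risk is the quadratic form of the covariance. -/
lemma excessRisk_eq (h : WellSpecified D wstar σ) (h4 : Integrable (fun z : E × ℝ => ‖z.1‖ ^ 4) D)
    (w : E) : excessRisk D wstar w = (1 / 2) * ⟪w - wstar, covOp D (w - wstar)⟫ := by
  have hsq := integrable_inner_sq h4 (w - wstar)
  have hcross : Integrable (fun z : E × ℝ => ⟪z.1, w - wstar⟫ * (z.2 - ⟪wstar, z.1⟫)) D := by
    refine integrable_mul_noise h (φ := fun x => ⟪x, w - wstar⟫) (by fun_prop) ?_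
    refine ((integrable_const (1 : ℝ)).add hsq).mono' (by fun_prop) (ae_of_all _ fun z => ?_)
    rw [Real.norm_eq_abs]
    simp only [Pi.add_apply]
    nlinarith [sq_abs ⟪z.1, w - wstar⟫, sq_nonneg (|⟪z.1, w - wstar⟫| - 1)]
  have hn := (memLp_noise h).integrable_sq
  have h0 := integral_mul_noise h (φ := fun x => ⟪x, w - wstar⟫) (by fun_prop)
  have hexp : ∫ z, (z.2 - ⟪w, z.1⟫) ^ 2 ∂D
      = ∫ z, ((z.2 - ⟪wstar, z.1⟫) ^ 2 + (⟪z.1, w - wstar⟫ ^ 2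
          - 2 * (⟪z.1, w - wstar⟫ * (z.2 - ⟪wstar, z.1⟫)))) ∂D := by
    refine integral_congr_ae (ae_of_all _ fun z => ?_)
    simp only [inner_sub_right, real_inner_comm w z.1, real_inner_comm wstar z.1]
    ring
  have hsub : Integrable (fun z : E × ℝ => ⟪z.1, w - wstar⟫ ^ 2
      - 2 * (⟪z.1, w - wstar⟫ * (z.2 - ⟪wstar, z.1⟫))) D := hsq.sub (hcross.const_mul 2)
  rw [integral_add hn hsub, integral_sub hsq (hcross.const_mul 2), integral_const_mul, h0] at hexp
  rw [excessRisk, risk, risk, hexp, inner_covOp_self h4]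
  ring

end CovShift

namespace CovShift

/-! ### One phase of the bias and variance recursions -/

section

variable {E : Type*} [NormedAddCommGroup E] [InnerProductSpace ℝ E]

/-- The operator whose eigenvalues are accumulated by `accum`. -/
noncomputable def accumOp (γ : ℕ → ℝ) (T : E →L[ℝ] E) : ℕ → (E →L[ℝ] E)
  | 0 => 0
  | t + 1 => (1 - γ t • T) * accumOp γ T t * (1 - γ t • T) + γ t ^ 2 • T

lemma accumOp_isEigenbasis {ι : Type*} {b : HilbertBasis ι ℝ E} {T : E →L[ℝ] E} {f : ι → ℝ}
    (hT : IsEigenbasis T b f) (γ : ℕ → ℝ) (n : ℕ) :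
    IsEigenbasis (accumOp γ T n) b fun i => accum γ (f i) n := by
  induction n with
  | zero => exact IsEigenbasis.zero
  | succ n ih =>
    have h1 := IsEigenbasis.one.sub (hT.smul (γ n))
    convert ((h1.mul ih).mul h1).add (hT.smul (γ n ^ 2)) using 1
    · rfl
    · funext i
      simp only [accum]
      ring

/-- Completing the square writes `iterOp` as the conjugation of `A` plus `γ² (𝔼[xxᵀAxxᵀ] - ΣAΣ)`,
which is where the fourth moment bound enters. -/
lemma iterOp_ge [CompleteSpace E] [MeasurableSpace E] {D : Measure (E × ℝ)} {ι : Type*}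
    {b : HilbertBasis ι ℝ E} {β : ℝ} (hF : FourthMomentLower D b β) (γ : ℝ) {A : E →L[ℝ] E}
    (hA : A.IsPositive) :
    (1 - γ • covOp D) * A * (1 - γ • covOp D) + (γ ^ 2 * (β * trace b (covOp D * A))) • covOp D
      ≤ iterOp D γ A := by
  have h := hF.lower A hA
  rw [ContinuousLinearMap.le_def] at h ⊢
  convert h.smul_of_nonneg (sq_nonneg γ) using 1
  simp only [iterOp, sub_mul, mul_sub, one_mul, mul_one, smul_mul_assoc, mul_smul_comm, smul_sub,
    smul_add, smul_smul]
  rw [← sq]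
  abel

end

variable {E : Type*} [NormedAddCommGroup E] [InnerProductSpace ℝ E] [CompleteSpace E]
  [SecondCountableTopology E] [MeasurableSpace E] [BorelSpace E]
  {D : Measure (E × ℝ)} [IsProbabilityMeasure D] {ι : Type*} {b : HilbertBasis ι ℝ E} {μ : ι → ℝ}
  {β : ℝ}

/-- The part of a quadratic form in the directions with small eigenvalues hardly contracts. -/
lemma sqNorm_contraction_ge (h4 : Integrable (fun z : E × ℝ => ‖z.1‖ ^ 4) D)
    (he : IsEigenbasis (covOp D) b μ) {m g : ℝ} (hm : 10 ≤ m) (hg : 0 < g) (w : E) (t : ℕ) :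
    Real.exp (-9) * sqNorm (specPart b μ {i | 1 / (g * m) ≤ μ i}ᶜ) w
      ≤ sqNorm (covOp D) (contraction (decay m g) (covOp D) 0 t w) := by
  have hμ0 := eigenvalue_nonneg h4 he
  have hsum := summable_eigenvalue h4 he
  have hm0 : 0 < m := by linarith
  have hC := he.contraction (decay m g) 0 t
  have hS := specPart_isEigenbasis b (f := μ) (U := {i | 1 / (g * m) ≤ μ i}ᶜ) (hsum.subtype _)
  have h1 := ((hC.mul he).mul hC).hasSum_sq w
  simp only [mul_apply_eq_comp, ← hC.symm w] at h1
  refine hasSum_le (fun i => ?_) ((hS.hasSum_sq w).mul_left (Real.exp (-9))) h1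
  rw [← mul_assoc]
  refine mul_le_mul_of_nonneg_right ?_ (sq_nonneg _)
  simp only [zero_add, decay_mul]
  by_cases hi : 1 / (g * m) ≤ μ i
  · rw [Set.indicator_of_notMem (by simpa using hi), mul_zero, mul_right_comm, ← sq]
    exact mul_nonneg (sq_nonneg _) (hμ0 i)
  · rw [Set.indicator_of_mem (by simpa using hi), mul_right_comm, ← sq]
    refine mul_le_mul_of_nonneg_right ?_ (hμ0 i)
    refine exp_le_prod_decay hm (mul_nonneg hg.le (hμ0 i)) ?_ t
    rw [not_le, lt_div_iff₀ (by positivity)] at hi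
    rw [lt_div_iff₀ hm0]
    linarith

/-- Lower bound for a full phase of the recursion `A ↦ (ℐ - γ 𝒯(γ)) ∘ A + γ² ν 𝔼[x xᵀ]`. -/
theorem phase_ge (he : IsEigenbasis (covOp D) b μ) (hF : FourthMomentLower D b β) (hβ : 0 ≤ β)
    {m g : ℝ} (hm : 10 ≤ m) (hg : 0 < g) (hgG : g * ‖covOp D‖ < 1) {n : ℕ} (hn : m ≤ n)
    {ν : ℝ} (hν : 0 ≤ ν) {A : ℕ → E →L[ℝ] E}
    (hA : ∀ t < n, A (t + 1) = iterOp D (decay m g t) (A t) + (decay m g t ^ 2 * ν) • covOp D)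
    (hA0 : (A 0).IsPositive) {w : E} (hw : outer w ≤ A 0) :
    contraction (decay m g) (covOp D) 0 n * A 0 * contraction (decay m g) (covOp D) 0 n
      + (Real.exp (-18) / 4 / m * (β * sqNorm (specPart b μ {i | 1 / (g * m) ≤ μ i}ᶜ) w + ν))
        • rateOp b μ {i | 1 / (g * m) ≤ μ i} (m * g) ≤ A n := by
  classical
  have h4 := hF.finite_fourth
  have hμ0 := eigenvalue_nonneg h4 he
  have hsum := summable_eigenvalue h4 he
  have hm0 : 0 < m := by linarith
  have hG := he.isPositive hμ0
  set G := covOp D with hGdef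
  set C := contraction (decay m g) G 0 with hCdef
  set U : Set ι := {i | 1 / (g * m) ≤ μ i} with hU
  set q := sqNorm (specPart b μ Uᶜ) w with hq
  have hCe := fun t => he.contraction (decay m g) 0 t
  have hSe := fun t => accumOp_isEigenbasis he (decay m g) t
  have hSpos := fun t => (hSe t).isPositive fun i => accum_nonneg (hμ0 i) t
  have hq0 : 0 ≤ q := by
    have hS := specPart_isEigenbasis b (f := μ) (U := Uᶜ) (hsum.subtype _)
    exact (hS.isPositive fun i => Set.indicator_nonneg (fun j _ => hμ0 j) i).inner_nonneg_right w
  -- Effective noise level, uniform over the phase: label noise plus the noise produced by the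
  -- uncontracted tail of `w`.
  set r := β * (Real.exp (-9) * q) + ν with hr
  have hr0 : 0 ≤ r := by positivity
  have key : ∀ t ≤ n, C t * A 0 * C t + r • accumOp (decay m g) G t ≤ A t := by
    intro t
    induction t with
    | zero =>
      intro _
      simp [hCdef, contraction, accumOp]
    | succ t ih =>
      intro ht
      have ih' := ih (by omega)
      have hge : C t * A 0 * C t ≤ A t :=
        (loewner_le_add ((hSpos t).smul_of_nonneg hr0)).trans ih'
      have hApos : (A t).IsPositive := isPositive_of_le (isPositive_conj (hCe t).symm hA0) hge
      -- `A t` dominates the rank one operator of the contracted vector `C t w`, whose trace against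
      -- `G` is `‖C t w‖²_G`.
      have htr : Real.exp (-9) * q ≤ trace b (G * A t) := by
        refine (sqNorm_contraction_ge h4 he hm hg w t).trans ?_
        rw [← trace_mul_outer he, ← conj_outer (hCe t).symm]
        exact trace_mul_mono he hsum hμ0 ((loewner_conj (hCe t).symm hw).trans hge)
      rw [hA t (by omega)]
      set d := decay m g t with hd
      have hone : IsEigenbasis (1 - d • G) b fun i => 1 - d * μ i :=
        IsEigenbasis.one.sub (he.smul d)
      have hcomm : (1 - d • G) * C t = C t * (1 - d • G) := by
        refine (hone.mul (hCe t)).unique ?_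
        convert (hCe t).mul hone using 2
        ring
      have hCs : C (t + 1) = C t * (1 - d • G) := by
        rw [hCdef, contraction_succ, zero_add]
      have h1 := loewner_add (loewner_conj hone.symm ih')
        (loewner_smul_left (c := d ^ 2 * r) (d := d ^ 2 * (β * trace b (G * A t)) + d ^ 2 * ν)
          (by rw [← mul_add, hr]; gcongr) hG)
      refine le_trans (le_of_eq ?_) (h1.trans ?_)
      · have : C (t + 1) * A 0 * C (t + 1) = (1 - d • G) * (C t * A 0 * C t) * (1 - d • G) := by
          rw [hCs]
          nth_rewrite 1 [← hcomm]
          simp only [mul_assoc]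
        rw [this, accumOp, mul_add, add_mul, smul_add, smul_smul, mul_comm r, add_assoc]
        simp only [mul_smul_comm, smul_mul_assoc, ← hd]
      · rw [add_smul, ← add_assoc]
        exact loewner_add (iterOp_ge hF d hApos) le_rfl
  refine le_trans (loewner_add le_rfl ?_) (key n le_rfl)
  have hrate : IsEigenbasis (rateOp b μ U (m * g)) b
      fun i => if 1 / (g * m) ≤ μ i then (μ i)⁻¹ else (m * g) ^ 2 * μ i :=
    rateOp_isEigenbasis hsum (by positivity) b (m * g)
  refine (hrate.smul _).le ((hSe n).smul r) fun i => ?_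
  have hga : g * μ i ≤ 1 := (mul_le_mul_of_nonneg_left (he.eigenvalue_le_norm i) hg.le).trans hgG.le
  have hacc := accum_decay_ge hm hg (hμ0 i) hga hn
  refine le_trans ?_ (mul_le_mul_of_nonneg_left hacc hr0)
  rw [← mul_assoc]
  refine mul_le_mul_of_nonneg_right ?_ ?_
  -- One factor `exp (-9)` comes from the tail of `w`, the other from `accum_decay_ge`; `ν` is
  -- weakened as well to share one constant.
  · have h18 : Real.exp (-18) = Real.exp (-9) * Real.exp (-9) := by
      rw [← Real.exp_add]; norm_num
    have h9 : Real.exp (-9) ≤ 1 := Real.exp_le_one_iff.2 (by norm_num)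
    have hle : Real.exp (-9) * (β * q + ν) ≤ r := by
      rw [hr, mul_add]
      nlinarith
    have hpos : 0 ≤ Real.exp (-9) / 4 / m := by positivity
    calc Real.exp (-18) / 4 / m * (β * q + ν)
        = Real.exp (-9) / 4 / m * (Real.exp (-9) * (β * q + ν)) := by rw [h18]; ring
      _ ≤ Real.exp (-9) / 4 / m * r := mul_le_mul_of_nonneg_left hle hpos
      _ = _ := mul_comm _ _
  · have := hμ0 i
    split_ifs <;> positivity

end CovShift

namespace CovShift

/-! ### Second moments of the SGD iterates -/

variable {E : Type*} [NormedAddCommGroup E] [InnerProductSpace ℝ E] [CompleteSpace E]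
  [SecondCountableTopology E] [MeasurableSpace E] [BorelSpace E]

/-- `ρ` has a finite second moment, and `𝔼 ⟪a, x⟫² = ⟪a, A a⟫` under `ρ`. -/
structure HasSecondMoment (ρ : Measure E) (A : E →L[ℝ] E) : Prop where
  integrable : Integrable (fun x => ‖x‖ ^ 2) ρ
  integral_eq : ∀ a, ∫ x, ⟪a, x⟫ ^ 2 ∂ρ = ⟪a, A a⟫

lemma HasSecondMoment.integrable_inner_sq {ρ : Measure E} {A : E →L[ℝ] E}
    (hρ : HasSecondMoment ρ A) (a : E) : Integrable (fun x => ⟪a, x⟫ ^ 2) ρ := by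
  refine (hρ.integrable.const_mul (‖a‖ ^ 2)).mono' (by fun_prop) (ae_of_all _ fun x => ?_)
  rw [Real.norm_of_nonneg (by positivity), ← mul_pow, sq_le_sq, abs_mul, abs_norm, abs_norm]
  exact abs_real_inner_le_norm _ _

/-- One SGD step for the error `w - w*` with noise `y - ⟪w*, x⟫`. -/
noncomputable def errStep (γ : ℝ) (wstar η : E) (z : E × ℝ) : E :=
  η - (γ * (⟪z.1, η⟫ - (z.2 - ⟪wstar, z.1⟫))) • z.1

/-- `I - γ x xᵀ` is symmetric, so it can act on the test vector; the old error then enters only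
through an inner product with a vector depending on the sample. -/
lemma inner_errStep (γ : ℝ) (wstar η a : E) (z : E × ℝ) :
    ⟪a, errStep γ wstar η z⟫
      = ⟪a - (γ * ⟪z.1, a⟫) • z.1, η⟫ + γ * ⟪z.1, a⟫ * (z.2 - ⟪wstar, z.1⟫) := by
  simp only [errStep, inner_sub_left, inner_sub_right, inner_smul_left, inner_smul_right,
    RCLike.conj_to_real]
  rw [real_inner_comm z.1 a]
  ring

lemma continuous_errStep (γ : ℝ) (wstar : E) :
    Continuous fun p : E × (E × ℝ) => errStep γ wstar p.1 p.2 := by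
  unfold errStep; fun_prop

/-- The bound separates `η` from the sample, so integrability on the product space needs only the
second moment of `η`, the fourth of `x` and the noise variance. -/
lemma norm_errStep_sq_le (γ : ℝ) (wstar η : E) (z : E × ℝ) :
    ‖errStep γ wstar η z‖ ^ 2 ≤ ‖η‖ ^ 2 * (4 + 4 * γ ^ 2 * ‖z.1‖ ^ 4)
      + 2 * γ ^ 2 * (‖z.1‖ ^ 2 * (z.2 - ⟪wstar, z.1⟫) ^ 2) := by
  set e := z.2 - ⟪wstar, z.1⟫ with he
  have h1 : errStep γ wstar η z = (η - (γ * ⟪z.1, η⟫) • z.1) + (γ * e) • z.1 := by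
    rw [errStep, ← he, mul_sub, sub_smul]; abel
  have h2 : ‖errStep γ wstar η z‖ ≤ (‖η‖ + |γ| * ‖z.1‖ ^ 2 * ‖η‖) + |γ| * |e| * ‖z.1‖ := by
    rw [h1]
    refine (norm_add_le _ _).trans (add_le_add ((norm_sub_le _ _).trans (add_le_add le_rfl ?_)) ?_)
    · rw [norm_smul, Real.norm_eq_abs, abs_mul]
      have := mul_le_mul_of_nonneg_left (abs_real_inner_le_norm z.1 η)
        (mul_nonneg (abs_nonneg γ) (norm_nonneg z.1))
      linarith
    · rw [norm_smul, Real.norm_eq_abs, abs_mul]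
  refine (pow_le_pow_left₀ (norm_nonneg _) h2 2).trans ?_
  have hs : ∀ p q : ℝ, (p + q) ^ 2 ≤ 2 * p ^ 2 + 2 * q ^ 2 := fun p q => by
    nlinarith [sq_nonneg (p - q)]
  have h3 := hs (‖η‖ + |γ| * ‖z.1‖ ^ 2 * ‖η‖) (|γ| * |e| * ‖z.1‖)
  have h4 := hs ‖η‖ (|γ| * ‖z.1‖ ^ 2 * ‖η‖)
  simp only [mul_pow, sq_abs] at h3 h4
  nlinarith

variable {D : Measure (E × ℝ)} [IsProbabilityMeasure D] {σ : ℝ} {wstar : E}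

lemma integrable_norm_errStep_sq (h4 : Integrable (fun z : E × ℝ => ‖z.1‖ ^ 4) D)
    (hW : WellSpecified D wstar σ) {ρ : Measure E} [IsProbabilityMeasure ρ] {A : E →L[ℝ] E}
    (hρ : HasSecondMoment ρ A) (γ : ℝ) :
    Integrable (fun p : E × (E × ℝ) => ‖errStep γ wstar p.1 p.2‖ ^ 2) (ρ.prod D) := by
  have h1 := hρ.integrable.mul_prod ((integrable_const (4 : ℝ)).add (h4.const_mul (4 * γ ^ 2)))
  have h2 := ((integrable_mul_noise_sq hW (φ := fun x => ‖x‖ ^ 2) (by fun_prop)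
    (integrable_norm_sq h4)).const_mul (2 * γ ^ 2)).comp_snd ρ
  refine (h1.add h2).mono' ((continuous_errStep γ wstar).norm.pow 2).aestronglyMeasurable
    (ae_of_all _ fun p => ?_)
  rw [Real.norm_of_nonneg (by positivity)]
  exact norm_errStep_sq_le γ wstar p.1 p.2

/-- After expansion, every nonconstant term is a continuous linear functional of `x xᵀ` or `x xᵀ A x
xᵀ`, and such functionals commute with the integral. -/
lemma integral_inner_iter (h4 : Integrable (fun z : E × ℝ => ‖z.1‖ ^ 4) D) (γ : ℝ)
    (A : E →L[ℝ] E) (a : E) :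
    Integrable (fun z : E × ℝ => ⟪a - (γ * ⟪z.1, a⟫) • z.1, A (a - (γ * ⟪z.1, a⟫) • z.1)⟫) D ∧
    ∫ z, ⟪a - (γ * ⟪z.1, a⟫) • z.1, A (a - (γ * ⟪z.1, a⟫) • z.1)⟫ ∂D = ⟪a, iterOp D γ A a⟫ := by
  have hO := integrable_outer h4
  have hQ := integrable_outer_mul_mul h4 A
  let L₁ : (E →L[ℝ] E) →L[ℝ] ℝ := (innerSL ℝ a).comp (ContinuousLinearMap.apply ℝ E (A a))
  let L₂ : (E →L[ℝ] E) →L[ℝ] ℝ := ((innerSL ℝ a).comp A).comp (ContinuousLinearMap.apply ℝ E a)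
  let L₃ : (E →L[ℝ] E) →L[ℝ] ℝ := (innerSL ℝ a).comp (ContinuousLinearMap.apply ℝ E a)
  have h_integrable : Integrable (fun z : E × ℝ => ⟪a, A a⟫ - γ * (L₁ (outer z.1) + L₂ (outer z.1)
      - γ * L₃ (outer z.1 * A * outer z.1))) D :=
    (integrable_const _).sub ((((L₁.integrable_comp hO).add (L₂.integrable_comp hO)).sub
      ((L₃.integrable_comp hQ).const_mul γ)).const_mul γ)
  have heq : (fun z : E × ℝ => ⟪a - (γ * ⟪z.1, a⟫) • z.1, A (a - (γ * ⟪z.1, a⟫) • z.1)⟫)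
      = fun z : E × ℝ => ⟪a, A a⟫ - γ * (L₁ (outer z.1) + L₂ (outer z.1)
        - γ * L₃ (outer z.1 * A * outer z.1)) := by
    funext z
    simp only [L₁, L₂, L₃, ContinuousLinearMap.comp_apply, ContinuousLinearMap.apply_apply,
      innerSL_apply_apply, outer_apply, mul_apply_eq_comp, map_sub, map_smul, inner_sub_left,
      inner_sub_right, inner_smul_left, inner_smul_right, RCLike.conj_to_real]
    rw [real_inner_comm z.1 a]
    ring
  refine ⟨heq ▸ h_integrable, ?_⟩
  have hi₁ := L₁.integrable_comp hO
  have hi₂ := L₂.integrable_comp hO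
  have hi₃ := (L₃.integrable_comp hQ).const_mul γ
  have hi₁₂ : Integrable (fun z : E × ℝ => L₁ (outer z.1) + L₂ (outer z.1)) D := hi₁.add hi₂
  have hi₁₂₃ : Integrable (fun z : E × ℝ => L₁ (outer z.1) + L₂ (outer z.1)
      - γ * L₃ (outer z.1 * A * outer z.1)) D := hi₁₂.sub hi₃
  rw [heq, integral_sub (integrable_const _) (hi₁₂₃.const_mul γ), integral_const_mul,
    integral_sub hi₁₂ hi₃, integral_add hi₁ hi₂, integral_const_mul, L₁.integral_comp_comm hO,
    L₂.integral_comp_comm hO, L₃.integral_comp_comm hQ]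
  simp only [L₁, L₂, L₃, ContinuousLinearMap.comp_apply, ContinuousLinearMap.apply_apply,
    innerSL_apply_apply, iterOp, sub_apply, add_apply, smul_apply, mul_apply_eq_comp,
    inner_sub_right, inner_add_right, inner_smul_right, integral_const, probReal_univ, one_smul]
  rfl

/-- One SGD step maps second moments by `A ↦ (ℐ - γ 𝒯(γ)) ∘ A + γ² 𝔼[ε² x xᵀ]`. -/
lemma HasSecondMoment.errStep (h4 : Integrable (fun z : E × ℝ => ‖z.1‖ ^ 4) D)
    (hW : WellSpecified D wstar σ) {ρ : Measure E} [IsProbabilityMeasure ρ] {A : E →L[ℝ] E}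
    (hρ : HasSecondMoment ρ A) (γ : ℝ) :
    HasSecondMoment ((ρ.prod D).map fun p => errStep γ wstar p.1 p.2)
      (iterOp D γ A + γ ^ 2 • noiseOp D wstar) := by
  have hcont := continuous_errStep γ wstar
  have h_integrable := integrable_norm_errStep_sq h4 hW hρ γ
  refine ⟨?_, fun a => ?_⟩
  · rw [integrable_map_measure (by fun_prop) (by fun_prop)]
    exact h_integrable
  rw [integral_map (by fun_prop) (by fun_prop), integral_prod_symm]
  swap
  · refine (h_integrable.const_mul (‖a‖ ^ 2)).mono'
      ((continuous_const.inner hcont).pow 2).aestronglyMeasurable (ae_of_all _ fun p => ?_)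
    rw [Real.norm_of_nonneg (by positivity), ← mul_pow, sq_le_sq, abs_mul, abs_norm, abs_norm]
    exact abs_real_inner_le_norm _ _
  have hid : Integrable (fun x : E => x) ρ := by
    refine ((integrable_const (1 : ℝ)).add hρ.integrable).mono' (by fun_prop)
      (ae_of_all _ fun x => ?_)
    simp only [Pi.add_apply]
    nlinarith [sq_nonneg (‖x‖ - 1)]
  -- The mean error need not vanish. It appears only in the term linear in the label noise, which
  -- integrates to zero.
  set c := ∫ x, x ∂ρ with hc
  have hlin : ∀ d : E, ∫ x, ⟪d, x⟫ ∂ρ = ⟪d, c⟫ := fun d => integral_inner hid d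
  have hinner : ∀ z : E × ℝ, ∫ x, ⟪a, CovShift.errStep γ wstar x z⟫ ^ 2 ∂ρ
      = ⟪a - (γ * ⟪z.1, a⟫) • z.1, A (a - (γ * ⟪z.1, a⟫) • z.1)⟫
        + ((2 * γ * ⟪z.1, a⟫ * ⟪a - (γ * ⟪z.1, a⟫) • z.1, c⟫) * (z.2 - ⟪wstar, z.1⟫)
          + γ ^ 2 * (⟪z.1, a⟫ ^ 2 * (z.2 - ⟪wstar, z.1⟫) ^ 2)) := by
    intro z
    set d := a - (γ * ⟪z.1, a⟫) • z.1 with hd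
    set e := z.2 - ⟪wstar, z.1⟫ with he
    have h1 : (fun x => ⟪a, CovShift.errStep γ wstar x z⟫ ^ 2)
        = fun x => ⟪d, x⟫ ^ 2 + ((2 * (γ * ⟪z.1, a⟫ * e)) * ⟪d, x⟫ + (γ * ⟪z.1, a⟫ * e) ^ 2) := by
      funext x
      rw [inner_errStep]
      ring
    have hl : Integrable (fun x => (2 * (γ * ⟪z.1, a⟫ * e)) * ⟪d, x⟫) ρ :=
      (hid.const_inner d).const_mul _
    have hl2 : Integrable (fun x => (2 * (γ * ⟪z.1, a⟫ * e)) * ⟪d, x⟫ + (γ * ⟪z.1, a⟫ * e) ^ 2) ρ :=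
      hl.add (integrable_const _)
    rw [h1, integral_add (hρ.integrable_inner_sq d) hl2, integral_add hl (integrable_const _),
      integral_const_mul, hlin, hρ.integral_eq, integral_const, probReal_univ, one_smul]
    ring
  simp_rw [hinner]
  obtain ⟨hi, hv⟩ := integral_inner_iter h4 γ A a
  have hφm : Measurable fun x : E => 2 * γ * ⟪x, a⟫ * ⟪a - (γ * ⟪x, a⟫) • x, c⟫ := by fun_prop
  have hφ : Integrable (fun z : E × ℝ => 2 * γ * ⟪z.1, a⟫ * ⟪a - (γ * ⟪z.1, a⟫) • z.1, c⟫) D := by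
    have hA := CovShift.integrable_inner_sq h4 a
    have h1 : Integrable (fun z : E × ℝ => |2 * γ * ⟪a, c⟫| * (1 + ⟪z.1, a⟫ ^ 2)
        + 2 * γ ^ 2 * ((⟪z.1, a⟫ ^ 2) * |⟪z.1, c⟫|)) D := by
      refine (((integrable_const (1 : ℝ)).add hA).const_mul _).add (Integrable.const_mul ?_ _)
      refine (((integrable_norm_sq h4).add h4).const_mul (‖a‖ ^ 2 * ‖c‖)).mono' (by fun_prop)
        (ae_of_all _ fun z => ?_)
      rw [Real.norm_of_nonneg (by positivity)]
      have e1 : ⟪z.1, a⟫ ^ 2 ≤ (‖z.1‖ * ‖a‖) ^ 2 :=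
        sq_le_sq.2 (by rw [abs_mul, abs_norm, abs_norm]; exact abs_real_inner_le_norm _ _)
      have e2 := abs_real_inner_le_norm z.1 c
      refine (mul_le_mul e1 e2 (abs_nonneg _) (by positivity)).trans ?_
      -- The cross term is cubic in `x`; its third moment is controlled by the second and fourth.
      have e3 : ‖z.1‖ ^ 3 ≤ ‖z.1‖ ^ 2 + ‖z.1‖ ^ 4 := by
        nlinarith [sq_nonneg (‖z.1‖ * (‖z.1‖ - 1)), sq_nonneg ‖z.1‖, norm_nonneg z.1,
          pow_nonneg (norm_nonneg z.1) 4]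
      have e4 := mul_le_mul_of_nonneg_left e3 (show 0 ≤ ‖a‖ ^ 2 * ‖c‖ by positivity)
      simp only [Pi.add_apply]
      nlinarith
    refine h1.mono' (hφm.comp measurable_fst).aestronglyMeasurable (ae_of_all _ fun z => ?_)
    have e1 : 2 * γ * ⟪z.1, a⟫ * ⟪a - (γ * ⟪z.1, a⟫) • z.1, c⟫
        = 2 * γ * ⟪a, c⟫ * ⟪z.1, a⟫ - 2 * γ ^ 2 * (⟪z.1, a⟫ ^ 2 * ⟪z.1, c⟫) := by
      rw [inner_sub_left, inner_smul_left, RCLike.conj_to_real]; ring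
    rw [e1, Real.norm_eq_abs]
    refine (abs_sub _ _).trans (add_le_add ?_ (le_of_eq ?_))
    · rw [abs_mul]
      refine mul_le_mul_of_nonneg_left ?_ (abs_nonneg _)
      nlinarith [sq_abs ⟪z.1, a⟫, sq_nonneg (|⟪z.1, a⟫| - 1)]
    · rw [abs_mul, abs_mul (⟪z.1, a⟫ ^ 2), abs_of_nonneg (sq_nonneg ⟪z.1, a⟫),
        abs_of_nonneg (by positivity)]
  have hcross := integrable_mul_noise hW hφm hφ
  have hsq := integrable_mul_noise_sq hW (φ := fun x => ⟪x, a⟫ ^ 2) (by fun_prop)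
    (CovShift.integrable_inner_sq h4 a)
  rw [integral_add hi, integral_add hcross (hsq.const_mul _), hv, integral_mul_noise hW hφm,
    integral_const_mul, integral_mul_noise_sq hW (φ := fun x => ⟪x, a⟫ ^ 2) (by fun_prop),
    ← inner_covOp_self h4, noiseOp_eq hW h4, add_apply, inner_add_right, smul_apply, smul_apply,
    inner_smul_right, inner_smul_right]
  · ring
  · exact hcross.add (hsq.const_mul _)

end CovShift

namespace CovShift

/-! ### Bias–variance decomposition of the excess risk -/

variable {E : Type*} [NormedAddCommGroup E] [InnerProductSpace ℝ E] [CompleteSpace E]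
  [SecondCountableTopology E] [MeasurableSpace E] [BorelSpace E]

lemma sgd_succ_sub (γ : ℕ → ℝ) (w₀ wstar : E) (z : ℕ → E × ℝ) (t : ℕ) :
    sgd γ w₀ z (t + 1) - wstar = errStep (γ t) wstar (sgd γ w₀ z t - wstar) (z t) := by
  rw [sgd, errStep, outer_apply, inner_sub_right, real_inner_comm wstar (z t).1]
  module

lemma sgd_congr {γ : ℕ → ℝ} {w₀ : E} {z z' : ℕ → E × ℝ} {t : ℕ} (h : ∀ s < t, z s = z' s) :
    sgd γ w₀ z t = sgd γ w₀ z' t := by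
  induction t with
  | zero => rfl
  | succ t ih => rw [sgd, sgd, ih fun s hs => h s (by omega), h t (by omega)]

lemma measurable_sgd (γ : ℕ → ℝ) (w₀ : E) (t : ℕ) :
    Measurable fun z : ℕ → E × ℝ => sgd γ w₀ z t := by
  induction t with
  | zero => exact measurable_const
  | succ t ih =>
    simp only [sgd, outer_apply]
    fun_prop

/-! ### Measurability of the iterates and their independence from the next sample. -/

section Iterates

variable {Ω : Type*} [MeasurableSpace Ω] {P : Measure Ω} [IsProbabilityMeasure P]
  {Z : ℕ → Ω → E × ℝ} {n : ℕ}

/-- The iterate at time `t` as a function of the samples before time `t`. -/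
lemma exists_sgd_eq (γ : ℕ → ℝ) (w₀ : E) {t : ℕ} (ht : t ≤ n) :
    ∃ φ : ((Finset.univ.filter fun i : Fin n => (i : ℕ) < t) → E × ℝ) → E, Measurable φ ∧
      ∀ z : ℕ → E × ℝ, sgd γ w₀ z t = φ fun i => z (i : Fin n) := by
  -- The value `0` assigned to samples from time `t` on is never read by `sgd` at time `t`.
  refine ⟨fun y => sgd γ w₀ (fun s => if h : s < t then
    y ⟨⟨s, h.trans_le ht⟩, Finset.mem_filter.2 ⟨Finset.mem_univ _, h⟩⟩ else 0) t, ?_, fun z => ?_⟩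
  · refine (measurable_sgd γ w₀ t).comp (measurable_pi_lambda _ fun s => ?_)
    by_cases h : s < t
    · simp only [h, dite_true]
      exact measurable_pi_apply _
    · simp only [h, dite_false]
      exact measurable_const
  · refine sgd_congr fun s hs => ?_
    simp [hs]

lemma aemeasurable_sgd (γ : ℕ → ℝ) (w₀ : E) (hZ : ∀ t < n, AEMeasurable (Z t) P) {t : ℕ}
    (ht : t ≤ n) : AEMeasurable (fun ω => sgd γ w₀ (fun s => Z s ω) t) P := by
  obtain ⟨φ, hφ, h⟩ := exists_sgd_eq γ w₀ ht
  simp_rw [h]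
  exact hφ.comp_aemeasurable (aemeasurable_pi_lambda _ fun i => hZ _ i.1.2)

lemma indepFun_sgd (γ : ℕ → ℝ) (w₀ : E) (hZ : ∀ t < n, AEMeasurable (Z t) P)
    (hind : iIndepFun (fun t : Fin n => Z t) P) {t : ℕ} (ht : t < n) :
    IndepFun (fun ω => sgd γ w₀ (fun s => Z s ω) t) (Z t) P := by
  obtain ⟨φ, hφ, h⟩ := exists_sgd_eq γ w₀ ht.le
  simp_rw [h]
  have hdisj : Disjoint (Finset.univ.filter fun i : Fin n => (i : ℕ) < t) {⟨t, ht⟩} := by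
    simp
  have := hind.indepFun_finset₀ _ _ hdisj fun i => hZ _ i.2
  exact this.comp hφ (measurable_pi_apply (⟨⟨t, ht⟩, Finset.mem_singleton_self _⟩ :
    ({⟨t, ht⟩} : Finset (Fin n))))

end Iterates

/-- Additivity merges the bias and variance recursions into a single recursion for the second
moment. -/
lemma iterOp_add {D : Measure (E × ℝ)} [IsProbabilityMeasure D]
    (h4 : Integrable (fun z : E × ℝ => ‖z.1‖ ^ 4) D) (γ : ℝ) (A B : E →L[ℝ] E) :
    iterOp D γ (A + B) = iterOp D γ A + iterOp D γ B := by
  have : fourthOp D (A + B) = fourthOp D A + fourthOp D B := by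
    unfold fourthOp
    rw [← integral_add]
    · simp only [mul_add, add_mul]
    · exact integrable_outer_mul_mul h4 A
    · exact integrable_outer_mul_mul h4 B
  simp only [iterOp, this, mul_add, add_mul, smul_add, smul_sub]
  abel

/-- The law of the error of the `t`-th iterate has second moment `B_t + C_t`. -/
theorem hasSecondMoment_sgd {DS DT : Measure (E × ℝ)} [IsProbabilityMeasure DS]
    [IsProbabilityMeasure DT] (hS : Integrable (fun z : E × ℝ => ‖z.1‖ ^ 4) DS)
    (hT : Integrable (fun z : E × ℝ => ‖z.1‖ ^ 4) DT) {wstar : E} {σ : ℝ}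
    (hWS : WellSpecified DS wstar σ) (hWT : WellSpecified DT wstar σ) {M n : ℕ} (γ : ℕ → ℝ) (w₀ : E)
    {Ω : Type*} [MeasurableSpace Ω] {P : Measure Ω} [IsProbabilityMeasure P] {Z : ℕ → Ω → E × ℝ}
    (hind : iIndepFun (fun t : Fin n => Z t) P)
    (hlaw : ∀ t < n, HasLaw (Z t) (phaseLaw DS DT M t) P) {t : ℕ} (ht : t ≤ n) :
    HasSecondMoment (P.map fun ω => sgd γ w₀ (fun s => Z s ω) t - wstar)
      (biasIter DS DT M γ w₀ wstar t + varIter DS DT M γ wstar t) := by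
  have hZ : ∀ t < n, AEMeasurable (Z t) P := fun t ht => (hlaw t ht).aemeasurable
  induction t with
  | zero =>
    have : (P.map fun ω => sgd γ w₀ (fun s => Z s ω) 0 - wstar) = Measure.dirac (w₀ - wstar) := by
      simp [sgd]
    rw [this]
    refine ⟨integrable_dirac (by simp), fun a => ?_⟩
    rw [integral_dirac, biasIter, varIter, add_zero, inner_outer, real_inner_comm]
  | succ t ih =>
    have ih' := ih (by omega)
    have hX := (aemeasurable_sgd γ w₀ hZ (Nat.le_of_succ_le ht)).sub_const wstar
    have hXZ : IndepFun (fun ω => sgd γ w₀ (fun s => Z s ω) t - wstar) (Z t) P :=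
      (indepFun_sgd γ w₀ hZ hind (by omega)).comp (measurable_id.sub_const wstar) measurable_id
    set X := fun ω => sgd γ w₀ (fun s => Z s ω) t - wstar with hXdef
    have hprob : IsProbabilityMeasure (P.map X) := Measure.isProbabilityMeasure_map hX
    have hpl : IsProbabilityMeasure (phaseLaw DS DT M t) := by
      unfold phaseLaw; split_ifs <;> infer_instance
    have h4 : Integrable (fun z : E × ℝ => ‖z.1‖ ^ 4) (phaseLaw DS DT M t) := by
      unfold phaseLaw; split_ifs <;> assumption
    have hW : WellSpecified (phaseLaw DS DT M t) wstar σ := by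
      unfold phaseLaw; split_ifs <;> assumption
    have hstep := ih'.errStep h4 hW (γ t)
    have hjoint : P.map (fun ω => (X ω, Z t ω)) = (P.map X).prod (phaseLaw DS DT M t) := by
      rw [(indepFun_iff_map_prod_eq_prod_map_map hX (hZ t (by omega))).1 hXZ,
        (hlaw t (by omega)).map_eq]
    have hmap : (P.map fun ω => sgd γ w₀ (fun s => Z s ω) (t + 1) - wstar)
        = ((P.map X).prod (phaseLaw DS DT M t)).map fun p => errStep (γ t) wstar p.1 p.2 := by
      rw [← hjoint, AEMeasurable.map_map_of_aemeasurable
        (continuous_errStep _ _).measurable.aemeasurable (hX.prodMk (hZ t (by omega)))]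
      congr 1
      funext ω
      rw [sgd_succ_sub]
      rfl
    rw [hmap]
    convert hstep using 1
    rw [biasIter, varIter, iterOp_add h4]
    abel

/-- The expectation of a trace class quadratic form in terms of second moments. -/
lemma HasSecondMoment.integral_quadratic {ρ : Measure E} {A T : E →L[ℝ] E}
    (hρ : HasSecondMoment ρ A) {κ : Type*} {b : HilbertBasis κ ℝ E} {f : κ → ℝ}
    (hT : IsEigenbasis T b f) (hf : Summable f) :
    Integrable (fun x => ⟪x, T x⟫) ρ ∧ ∫ x, ⟪x, T x⟫ ∂ρ = trace b (T * A) := by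
  constructor
  · refine (hρ.integrable.const_mul ‖T‖).mono' (by fun_prop) (ae_of_all _ fun x => ?_)
    refine (abs_real_inner_le_norm _ _).trans ?_
    have := mul_le_mul_of_nonneg_left (T.le_opNorm x) (norm_nonneg x)
    linarith
  · have h_integrable : ∀ i, ∫ x, f i * ⟪b i, x⟫ ^ 2 ∂ρ = f i * ⟪b i, A (b i)⟫ := fun i => by
      rw [integral_const_mul, hρ.integral_eq]
    -- Exchanging sum and integral requires a countable index set; summability of `f` makes its
    -- support countable.
    have : Countable (Function.support f) := hf.countable_support.to_subtype
    have hsub : ∀ g : κ → ℝ, ∑' i : Function.support f, f i * g i = ∑' i, f i * g i := fun g =>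
      tsum_subtype_eq_of_support_subset (f := fun i => f i * g i)
        (Function.support_mul_subset_left f g)
    have hsum : Summable fun i : Function.support f => ∫ x, ‖f i * ⟪b i, x⟫ ^ 2‖ ∂ρ := by
      have h1 := (summable_trace b hf.abs A).subtype (Function.support f)
      refine h1.congr fun i => ?_
      simp only [Function.comp, norm_mul, norm_pow, Real.norm_eq_abs, sq_abs]
      rw [integral_const_mul, hρ.integral_eq]
    have h := (hasSum_integral_of_summable_integral_norm
      (fun i : Function.support f => (hρ.integrable_inner_sq (b i)).const_mul (f i)) hsum).tsum_eq
    simp only [h_integrable] at h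
    rw [hsub fun i => ⟪b i, A (b i)⟫, ← trace_mul_eq hT] at h
    rw [h]
    refine integral_congr_ae (ae_of_all _ fun x => ?_)
    simp only
    rw [hsub fun i => ⟪b i, x⟫ ^ 2, (hT.hasSum_sq x).tsum_eq]

end CovShift

namespace CovShift

/-! ### Both phases -/

lemma stepsize_of_lt {M t : ℕ} (N : ℕ) (γ₀ γM : ℝ) (h : t < M) :
    stepsize M N γ₀ γM t = decay (nEff M) γ₀ t := if_pos h

lemma stepsize_add (M N : ℕ) (γ₀ γM : ℝ) (t : ℕ) :
    stepsize M N γ₀ γM (M + t) = decay (nEff N) γM t := by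
  rw [stepsize, if_neg (by omega), decay]
  push_cast
  rw [add_sub_cancel_left]

lemma dEff_nonneg {κ : Type*} (ev : κ → ℝ) (K : Set κ) (a : ℝ) : 0 ≤ dEff ev K a := by
  unfold dEff
  have : 0 ≤ ∑' i : (Kᶜ : Set κ), ev i ^ 2 := tsum_nonneg fun i => sq_nonneg _
  positivity

/-- Comparison of the bias expressions `L = a + β q X + β p Y` and `U = a + α Q X + α (p' + Q) Y` in
the presence of the variance `V = s (X + Y)`, for signals `Q, p' ≤ R s`. -/
lemma rate_comparison {a X Y q Q p p' α β R s c : ℝ} (ha : 0 ≤ a) (hX : 0 ≤ X) (hY : 0 ≤ Y)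
    (hq : 0 ≤ q) (hp : 0 ≤ p) (hqQ : q ≤ Q) (hpp : p ≤ p') (hQ : Q ≤ R * s) (hp' : p' ≤ R * s)
    (hβ : 0 < β) (hα : β ≤ α) (hs : 0 < s) (hc : c ≤ 1 / 2) :
    s * (X + Y) + (a + β * q * X + β * p * Y) ≤ s * (X + Y) + (a + α * Q * X + α * (p' + Q) * Y) ∧
    c * (s * (X + Y) + (a + α * Q * X + α * (p' + Q) * Y))
      ≤ (1 + α * R) * (s * (X + Y) + (a + β * q * X + β * p * Y)) := by
  have hα0 : 0 ≤ α := hβ.le.trans hα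
  have hQ0 : 0 ≤ Q := hq.trans hqQ
  have hp0 : 0 ≤ p' := hp.trans hpp
  have hR : 0 ≤ R := nonneg_of_mul_nonneg_left (hQ0.trans hQ) hs
  have h1 : β * q * X ≤ α * Q * X := by gcongr
  have h2 : β * p * Y ≤ α * (p' + Q) * Y := by
    gcongr
    linarith
  refine ⟨by linarith, ?_⟩
  have h3 : α * Q * X ≤ α * (R * s) * X := by gcongr
  have h4 : α * (p' + Q) * Y ≤ α * (R * s + R * s) * Y := by gcongr
  have hαR : 0 ≤ α * R := mul_nonneg hα0 hR
  have h5 : 0 ≤ β * q * X := by positivity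
  have h6 : 0 ≤ β * p * Y := by positivity
  calc c * (s * (X + Y) + (a + α * Q * X + α * (p' + Q) * Y))
      ≤ 1 / 2 * (s * (X + Y) + (a + α * Q * X + α * (p' + Q) * Y)) :=
        mul_le_mul_of_nonneg_right hc (by positivity)
    _ ≤ 1 / 2 * (s * (X + Y) + (a + α * (R * s) * X + α * (R * s + R * s) * Y)) := by linarith
    -- The factor `1/2` cancels the doubling `R s + R s` that comes from `p' + Q`.
    _ ≤ (1 + α * R) * (s * (X + Y) + a) := by
        have e1 : 0 ≤ s * X := by positivity
        have e2 : 0 ≤ s * Y := by positivity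
        nlinarith [mul_nonneg hαR e1, mul_nonneg hαR ha]
    _ ≤ _ := mul_le_mul_of_nonneg_left (by linarith) (by positivity)

variable {E : Type*} [NormedAddCommGroup E] [InnerProductSpace ℝ E] [CompleteSpace E]

/-! ### Positivity and comparison of head and tail quadratic forms. -/

section Spectral

variable {ι : Type*} {b : HilbertBasis ι ℝ E} {T : E →L[ℝ] E} {f : ι → ℝ}

lemma rateOp_isPositive (hf : Summable f) (hf0 : ∀ i, 0 ≤ f i) {r : ℝ} (hr : 0 < r) (a : ℝ) :
    (rateOp b f {i | r ≤ f i} a).IsPositive := by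
  classical
  refine (rateOp_isEigenbasis hf hr b a).isPositive fun i => ?_
  have := hf0 i
  split_ifs <;> positivity

lemma sqNorm_tail_nonneg (hf : Summable f) (hf0 : ∀ i, 0 ≤ f i) (U : Set ι) (w : E) :
    0 ≤ sqNorm (specPart b f U) w :=
  ((specPart_isEigenbasis b (hf.subtype U)).isPositive fun i =>
    Set.indicator_nonneg (fun j _ => hf0 j) i).inner_nonneg_right w

/-- `‖w‖²_{T_{Uᶜ}} ≤ ‖w‖²_{r I_U + T_{Uᶜ}} ≤ ‖w‖²_T`, where `U` holds the eigenvalues `≥ r`. -/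
lemma sqNorm_headTail (hT : IsEigenbasis T b f) (hf : Summable f) {r : ℝ} (hr : 0 < r) (w : E) :
    sqNorm (specPart b f {i | r ≤ f i}ᶜ) w
      ≤ sqNorm (specPart b (fun _ => r) {i | r ≤ f i} + specPart b f {i | r ≤ f i}ᶜ) w ∧
    sqNorm (specPart b (fun _ => r) {i | r ≤ f i} + specPart b f {i | r ≤ f i}ᶜ) w
      ≤ sqNorm T w := by
  have := (finite_setOf_le hf hr).to_subtype
  have h1 := specPart_isEigenbasis b (f := fun _ => r) (U := {i | r ≤ f i})
    (summable_of_hasFiniteSupport (Set.toFinite _))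
  have h2 := specPart_isEigenbasis b (f := f) (U := {i | r ≤ f i}ᶜ) (hf.subtype _)
  refine ⟨inner_le_of_loewner (h2.le (h1.add h2) fun i => ?_) w,
    inner_le_of_loewner ((h1.add h2).le hT fun i => ?_) w⟩ <;>
  by_cases hi : r ≤ f i <;> simp [hi, hr.le]

lemma dEffFinetune_nonneg {κ : Type*} {bH : HilbertBasis κ ℝ E} {H : E →L[ℝ] E} {ev : κ → ℝ}
    (hH : IsEigenbasis H bH ev) (hev : ∀ k, 0 ≤ ev k) (hf : Summable f) (hf0 : ∀ i, 0 ≤ f i)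
    {r : ℝ} (hr : 0 < r) (γ : ℕ → ℝ) (M N : ℕ) (a : ℝ) :
    0 ≤ dEffFinetune b f {i | r ≤ f i} bH H γ M N a := by
  have hC := hH.contraction γ M N
  have h := trace_mul_nonneg hH hev (isPositive_conj hC.symm (rateOp_isPositive (b := b) hf hf0 hr a))
  rwa [trace_mul_conj hH hC] at h

end Spectral

variable [SecondCountableTopology E] [MeasurableSpace E] [BorelSpace E]

/-- Lower bound for pretraining followed by finetuning. -/
theorem two_phase_ge {DS DT : Measure (E × ℝ)} [IsProbabilityMeasure DS] [IsProbabilityMeasure DT]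
    {ι κ : Type*} {bG : HilbertBasis ι ℝ E} {μ : ι → ℝ} {bH : HilbertBasis κ ℝ E} {ev : κ → ℝ}
    (hG : IsEigenbasis (covOp DS) bG μ) (hH : IsEigenbasis (covOp DT) bH ev) {β : ℝ} (hβ : 0 ≤ β)
    (hFS : FourthMomentLower DS bG β) (hFT : FourthMomentLower DT bH β) {M N : ℕ} {γ₀ γM : ℝ}
    (hM : 10 ≤ nEff M) (hN : 10 ≤ nEff N) (hγ₀ : 0 < γ₀) (hγM : 0 < γM)
    (hγG : γ₀ * ‖covOp DS‖ < 1) (hγH : γM * ‖covOp DT‖ < 1) {ν : ℝ} (hν : 0 ≤ ν)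
    {A : ℕ → E →L[ℝ] E}
    (hA : ∀ t, A (t + 1) = iterOp (phaseLaw DS DT M t) (stepsize M N γ₀ γM t) (A t)
      + (stepsize M N γ₀ γM t ^ 2 * ν) • covOp (phaseLaw DS DT M t))
    {w : E} (hw : A 0 = outer w) :
    let γ := stepsize M N γ₀ γM
    let J : Set ι := {j | 1 / (γ₀ * nEff M) ≤ μ j}
    let K : Set κ := {k | 1 / (γM * nEff N) ≤ ev k}
    let v := contraction γ (covOp DS) 0 M w
    sqNorm (covOp DT) (contraction γ (covOp DT) M N v)
      + Real.exp (-18) / 4 / nEff M * (β * sqNorm (specPart bG μ Jᶜ) w + ν)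
        * dEffFinetune bG μ J bH (covOp DT) γ M N (nEff M * γ₀)
      + Real.exp (-18) / 4 / nEff N * (β * sqNorm (specPart bH ev Kᶜ) v + ν)
        * dEff ev K (nEff N * γM)
      ≤ trace bH (covOp DT * A (M + N)) := by
  intro γ J K v
  have hμ0 := eigenvalue_nonneg hFS.finite_fourth hG
  have hμs := summable_eigenvalue hFS.finite_fourth hG
  have hev0 := eigenvalue_nonneg hFT.finite_fourth hH
  have hevs := summable_eigenvalue hFT.finite_fourth hH
  have hM0 : 0 < nEff M := by linarith
  have hN0 : 0 < nEff N := by linarith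
  have hrJ : 0 < 1 / (γ₀ * nEff M) := by positivity
  have hrK : 0 < 1 / (γM * nEff N) := by positivity
  have hCG : contraction (decay (nEff M) γ₀) (covOp DS) 0 M = contraction γ (covOp DS) 0 M :=
    contraction_congr (fun t ht => by
      rw [zero_add]; exact (stepsize_of_lt N γ₀ γM ht).symm) _
  have hCH : contraction (decay (nEff N) γM) (covOp DT) 0 N = contraction γ (covOp DT) M N :=
    contraction_congr (fun t _ => by rw [zero_add]; exact (stepsize_add M N γ₀ γM t).symm) _
  have hCe := hG.contraction γ 0 M
  have hCe' := hH.contraction γ M N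
  set rJ := Real.exp (-18) / 4 / nEff M * (β * sqNorm (specPart bG μ Jᶜ) w + ν) with hrJdef
  set rK := Real.exp (-18) / 4 / nEff N * (β * sqNorm (specPart bH ev Kᶜ) v + ν) with hrKdef
  have hrJ0 : 0 ≤ rJ := by
    have := sqNorm_tail_nonneg (b := bG) hμs hμ0 Jᶜ w
    positivity
  have hX := rateOp_isPositive (b := bG) hμs hμ0 hrJ (nEff M * γ₀)
  have h1 : outer v + rJ • rateOp bG μ J (nEff M * γ₀) ≤ A M := by
    have h := phase_ge hG hFS hβ hM hγ₀ hγG (le_of_ten_le_nEff hM) hν (A := A) (fun t ht => by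
      rw [hA t, phaseLaw, if_pos ht, stepsize_of_lt N γ₀ γM ht]) (hw ▸ outer_isPositive w) hw.ge
    rwa [hCG, hw, conj_outer hCe.symm] at h
  -- The target phase restarts from `A M`, which dominates the rank one operator of the contracted
  -- vector `v`; `v` therefore plays the role of `w` there.
  have hvM : outer v ≤ A M := (loewner_le_add (hX.smul_of_nonneg hrJ0)).trans h1
  have h2 := phase_ge hH hFT hβ hN hγM hγH (le_of_ten_le_nEff hN) hν (A := fun t => A (M + t))
    (fun t _ => by
      rw [← add_assoc, hA (M + t), phaseLaw, if_neg (by omega), stepsize_add])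
    (isPositive_of_le (outer_isPositive v) hvM) hvM
  rw [hCH] at h2
  -- The source noise also survives the target contraction; its trace against `H` is what produces
  -- `dEffFinetune`.
  have h3 := (loewner_add (loewner_conj hCe'.symm h1) le_rfl).trans h2
  have h4 := trace_mul_mono hH hevs hev0 h3
  rw [mul_add (contraction γ (covOp DT) M N), add_mul (_ * _), conj_outer hCe'.symm, mul_smul_comm,
    smul_mul_assoc, trace_mul_add hH hevs, trace_mul_add hH hevs, trace_mul_smul hH,
    trace_mul_smul hH, trace_mul_outer hH, trace_mul_conj hH hCe', trace_mul_rateOp hH hevs hrK] at h4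
  exact h4

end CovShift

/-! ### Assembly of the decomposition, the two lower bounds and the comparison of rates. -/

theorem theorem2 :
    ∃ c : ℝ, 0 < c ∧
    ∀ (E : Type*) [NormedAddCommGroup E] [InnerProductSpace ℝ E] [CompleteSpace E]
      [SecondCountableTopology E] [MeasurableSpace E] [BorelSpace E]
      -- source and target distributions of `(x, y)`
      (DS DT : Measure (E × ℝ)) [IsProbabilityMeasure DS] [IsProbabilityMeasure DT]
      -- eigenvectors and eigenvalues of `G` and `H`
      (ι κ : Type*) (bG : HilbertBasis ι ℝ E) (μ : ι → ℝ) (bH : HilbertBasis κ ℝ E) (ev : κ → ℝ)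
      (_ : IsEigenbasis (covOp DS) bG μ) (_ : IsEigenbasis (covOp DT) bH ev)
      -- moment and noise conditions
      (β σ : ℝ) (wstar : E) (_ : 0 < β) (_ : 0 < σ)
      (_ : FourthMomentLower DS bG β) (_ : FourthMomentLower DT bH β)
      (_ : WellSpecified DS wstar σ) (_ : WellSpecified DT wstar σ)
      -- sample sizes, stepsizes and initialization
      (M N : ℕ) (γ₀ γM : ℝ) (w₀ : E) (_ : 10 ≤ nEff M) (_ : 10 ≤ nEff N)
      (_ : 0 < γ₀) (_ : 0 < γM) (_ : γ₀ * ‖covOp DS‖ < 1) (_ : γM * ‖covOp DT‖ < 1)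
      -- independent samples: `M` from the source, then `N` from the target
      (Ω : Type*) [MeasurableSpace Ω] (P : Measure Ω) [IsProbabilityMeasure P]
      (Z : ℕ → Ω → E × ℝ)
      (_ : iIndepFun (fun t : Fin (M + N) => Z t) P)
      (_ : ∀ t < M + N, HasLaw (Z t) (phaseLaw DS DT M t) P),
      let G := covOp DS
      let H := covOp DT
      let γ := stepsize M N γ₀ γM
      let w := fun ω => sgd γ w₀ (fun t => Z t ω) (M + N)
      let J : Set ι := {j | 1 / (γ₀ * nEff M) ≤ μ j}
      let K : Set κ := {k | 1 / (γM * nEff N) ≤ ev k}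
      let D := dEff ev K (nEff N * γM)
      let Dft := dEffFinetune bG μ J bH H γ M N (nEff M * γ₀)
      -- `∏_{t<M} (I - γ_t G) (w₀ - w*)` and `∏_{M≤t<M+N} (I - γ_t H) ∏_{t<M} (I - γ_t G) (w₀ - w*)`
      let v := contraction γ G 0 M (w₀ - wstar)
      let u := contraction γ H M N v
      let bias := biasErr bH DS DT M N γ w₀ wstar
      let var := varErr bH DS DT M N γ wstar
      let varRate := σ ^ 2 * (Dft / nEff M + D / nEff N)
      let biasLower := sqNorm H u
        + β * sqNorm (specPart bG μ Jᶜ) (w₀ - wstar) * (Dft / nEff M)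
        + β * sqNorm (specPart bH ev Kᶜ) v * (D / nEff N)
      -- the bias expression of the matching upper bound, for an upper fourth moment constant `α`
      let headTail :=
        sqNorm (specPart bG (fun _ => 1 / (nEff M * γ₀)) J + specPart bG μ Jᶜ) (w₀ - wstar)
      let biasUpper := fun α : ℝ => sqNorm H u
        + α * headTail * (Dft / nEff M)
        + α * (sqNorm (specPart bH (fun _ => 1 / (nEff N * γM)) K + specPart bH ev Kᶜ) v
            + headTail) * (D / nEff N)
      (Integrable (fun ω => excessRisk DT wstar (w ω)) P ∧
        ∫ ω, excessRisk DT wstar (w ω) ∂P = bias + var) ∧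
      c * varRate ≤ var ∧
      c * biasLower ≤ bias ∧
      -- up to constants the lower bound matches the upper bound for bounded signal-to-noise ratios
      ∀ α R : ℝ, β ≤ α → sqNorm G (w₀ - wstar) ≤ R * σ ^ 2 → sqNorm H v ≤ R * σ ^ 2 →
        varRate + biasLower ≤ varRate + biasUpper α ∧
        c * (varRate + biasUpper α) ≤ (1 + α * R) * (varRate + biasLower) := by
  -- The constant `exp (-18) / 4` of `two_phase_ge`, times the `1/2` in the definitions of bias and
  -- variance.
  refine ⟨Real.exp (-18) / 8, by positivity, ?_⟩
  intro E _ _ _ _ _ _ DS DT _ _ ι κ bG μ bH ev hG hH β σ wstar hβ hσ hFS hFT hWS hWT M N γ₀ γM w₀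
    hM hN hγ₀ hγM hγG hγH Ω _ P _ Z hind hlaw G H γ w J K D Dft v u bias var varRate biasLower
    headTail biasUpper
  have hμ0 := eigenvalue_nonneg hFS.finite_fourth hG
  have hμs := summable_eigenvalue hFS.finite_fourth hG
  have hev0 := eigenvalue_nonneg hFT.finite_fourth hH
  have hevs := summable_eigenvalue hFT.finite_fourth hH
  have hM0 : 0 < nEff M := by linarith
  have hN0 : 0 < nEff N := by linarith
  have hrJ : 0 < 1 / (γ₀ * nEff M) := by positivity
  have hrK : 0 < 1 / (γM * nEff N) := by positivity
  have hc1 : Real.exp (-18) / 8 ≤ 1 / 8 := by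
    have := Real.exp_le_one_iff.2 (show (-18 : ℝ) ≤ 0 by norm_num)
    linarith
  have hu0 : 0 ≤ sqNorm H u := (hH.isPositive hev0).inner_nonneg_right u
  refine ⟨?_, ?_, ?_, ?_⟩
  · have hlawN := hasSecondMoment_sgd hFS.finite_fourth hFT.finite_fourth hWS hWT γ w₀ hind hlaw
      le_rfl
    have hmeas := (aemeasurable_sgd γ w₀ (fun t ht => (hlaw t ht).aemeasurable) le_rfl).sub_const
      wstar
    obtain ⟨hi, hv⟩ := hlawN.integral_quadratic hH hevs
    rw [integrable_map_measure (by fun_prop) hmeas] at hi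
    rw [integral_map hmeas (by fun_prop)] at hv
    simp_rw [excessRisk_eq hWT hFT.finite_fourth]
    refine ⟨hi.const_mul _, ?_⟩
    rw [integral_const_mul, hv, trace_mul_add hH hevs]
    simp only [bias, var, biasErr, varErr]
    ring
  -- Variance: zero initial vector and noise level `ν = σ²`, so all signal terms vanish.
  · have h := two_phase_ge hG hH hβ.le hFS hFT hM hN hγ₀ hγM hγG hγH (sq_nonneg σ)
      (A := varIter DS DT M γ wstar) (w := 0)
      (fun t => by
        have : noiseOp (phaseLaw DS DT M t) wstar = σ ^ 2 • covOp (phaseLaw DS DT M t) := by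
          unfold phaseLaw
          split_ifs
          · exact noiseOp_eq hWS hFS.finite_fourth
          · exact noiseOp_eq hWT hFT.finite_fourth
        rw [varIter, this, smul_smul])
      (by ext x; simp [varIter])
    simp only [sqNorm, map_zero, inner_zero_left, mul_zero, zero_add] at h
    simp only [var, varErr, varRate]
    refine le_trans (le_of_eq ?_) (mul_le_mul_of_nonneg_left h (by norm_num : (0 : ℝ) ≤ 1 / 2))
    simp only [D, Dft, H, J, K, γ]
    ring
  -- Bias: `ν = 0`, so the only noise is that generated by the random design.
  · have h := two_phase_ge hG hH hβ.le hFS hFT hM hN hγ₀ hγM hγG hγH le_rfl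
      (A := biasIter DS DT M γ w₀ wstar) (w := w₀ - wstar)
      (fun t => by rw [biasIter, mul_zero, zero_smul, add_zero]) rfl
    simp only [add_zero] at h
    simp only [bias, biasErr, biasLower]
    refine le_trans ?_ (mul_le_mul_of_nonneg_left h (by norm_num : (0 : ℝ) ≤ 1 / 2))
    have hu : Real.exp (-18) / 8 * sqNorm H u ≤ 1 / 2 * sqNorm H u :=
      mul_le_mul_of_nonneg_right (by linarith) hu0
    simp only [D, Dft, H, J, K, γ, v, u, G] at hu ⊢
    rw [mul_add, mul_add, mul_add, mul_add]
    refine add_le_add (add_le_add hu (le_of_eq ?_)) (le_of_eq ?_) <;> ring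
  · intro α R hα hR₁ hR₂
    have hDft : 0 ≤ Dft / nEff M :=
      div_nonneg (dEffFinetune_nonneg hH hev0 hμs hμ0 hrJ γ M N _) hM0.le
    have hD : 0 ≤ D / nEff N := div_nonneg (dEff_nonneg _ _ _) hN0.le
    have hqJ : 0 ≤ sqNorm (specPart bG μ Jᶜ) (w₀ - wstar) := sqNorm_tail_nonneg hμs hμ0 _ _
    have hqK : 0 ≤ sqNorm (specPart bH ev Kᶜ) v := sqNorm_tail_nonneg hevs hev0 _ _
    have hJ : sqNorm (specPart bG μ Jᶜ) (w₀ - wstar) ≤ headTail ∧ headTail ≤ sqNorm G (w₀ - wstar) := by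
      simp only [headTail, mul_comm (nEff M) γ₀]
      exact sqNorm_headTail hG hμs hrJ (w₀ - wstar)
    have hK := sqNorm_headTail hH hevs hrK v
    have hcomm : 1 / (nEff N * γM) = 1 / (γM * nEff N) := by rw [mul_comm]
    simp only [varRate, biasLower, biasUpper, hcomm]
    exact rate_comparison hu0 hDft hD hqJ hqK hJ.1 hK.1 (hJ.2.trans hR₁) (hK.2.trans hR₂) hβ hα
      (by positivity) (by linarith)
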